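/- Let $\Omega\subset\mathbb R^2$ be a bounded domain (open and connected) whose boundary is a disjoint union $\partial\Omega=\partial_1\Omega\cup\dots\cup\partial_q\Omega$ of $q$ piecewise smooth simple closed curves, where piecewise smooth means: consisting of finitely many arcs, each of class $C^1$ up to its endpoints. Fix a reference point on each $\partial_\alpha\Omega$ and parametrize $\partial_\alpha\Omega$ by arclength $0\le s<|\partial_\alpha\Omega|$, positively oriented (with $\Omega$ on the left). Let $\Phi$ be the set of phase points $z=(\alpha,s,\theta)$, $0\le s<|\partial_\alpha\Omega|$, $0\le\theta\le\pi$, where $(\alpha,s)$ is the footpoint $p(z)\in\partial_\alpha\Omega$ and $\theta$ is the angle from the positive tangent to the outgoing direction; let $d\nu=\sin\theta\,ds\,d\theta$ be the Liouville measure on $\Phi$, which is finite and nonzero. The billiard map $\varphi$ sends $z$ to the phase point after the next collision with $\partial\Omega$ (angle of reflection equal to angle of incidence); it is undefined if $p(z)$ or the next footpoint is a corner or if the ball leaves or arrives tangentially. Let $z\in\Phi$ be such that $\varphi^k(z)$ is defined for all $k\ge0$. For $1\le\alpha\le q$ and $N\in\mathbb N$ let $0\le k_0<\dots<k_n\le N$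 be all the times $k\le N$ with $p(\varphi^{k}(z))\in\partial_\alpha\Omega$, let $0\le s_0,\dots,s_n<|\partial_\alpha\Omega|$ be the arclength coordinates of these footpoints, and for $0\le i<n$ let $\xi_i\in[0,|\partial_\alpha\Omega|)$ be the number with $s_i+\xi_i\in\{s_{i+1},\,s_{i+1}+|\partial_\alpha\Omega|\}$. Put $$\upsilon_\alpha(z)=\lim_{N\to\infty}\frac{\xi_0+\dots+\xi_{n-1}}{N}$$ (the sum being $0$ if there are fewer than two visits). If these limits exist for all $\alpha$, we say that the footpoint gain vector $\vec\upsilon(z)=(\upsilon_1(z),\dots,\upsilon_q(z))$ and the rotation vector $\vec\rho(z)=\bigl(\upsilon_1(z)/|\partial_1\Omega|,\dots,\upsilon_q(z)/|\partial_q\Omega|\bigr)$ exist at $z$. Then: 1. $\vec\upsilon(z)$ and $\vec\rho(z)$ exist for $\nu$-almost every $z\in\Phi$; the set $E\subset\Phi$ of points where they exist is measurable and $\varphi$-invariant: where $\varphi(z)$ is defined, $z\in E$ if and only if $\varphi(z)\in E$. 2. The function $\vec\upsilon:E\to\mathbb R^q$ is measurable and $\varphi$-invariant, $0\le\upsilon_\alpha\le|\partial_\alpha\Omega|$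 on $E$ for all $\alpha$, each $\upsilon_\alpha$ is $\nu$-integrable, and $$0\le\frac{1}{\nu(\Phi)}\int_\Phi\upsilon_\alpha\,d\nu\le|\partial_\alpha\Omega|\qquad(1\le\alpha\le q).$$ 3. The function $\vec\rho:E\to\mathbb R^q$ is measurable and $\varphi$-invariant, $0\le\rho_\alpha\le1$ on $E$ for all $\alpha$, each $\rho_\alpha$ is $\nu$-integrable, and $$0\le\frac{1}{\nu(\Phi)}\int_\Phi\rho_\alpha\,d\nu\le1\qquad(1\le\alpha\le q).$$ -/

import Mathlib

open MeasureTheory Filter Topology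

/-- A `q`-connected planar billiard table; the plane is `ℂ`. The domain is bounded, open and
connected, and its boundary is the disjoint union of `q` simple closed curves, the `α`-th one being
parametrized by arclength, with period its length `len α`, from the reference point `bdry α 0`. -/
structure BilliardTable (q : ℕ) where
  domain : Set ℂ
  isOpen_domain : IsOpen domain
  isConnected_domain : IsConnected domain
  isBounded_domain : Bornology.IsBounded domain
  len : Fin q → ℝ
  len_pos : ∀ α, 0 < len α
  bdry : Fin q → ℝ → ℂ
  continuous_bdry : ∀ α, Continuous (bdry α)
  periodic_bdry : ∀ α, Function.Periodic (bdry α) (len α)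
  injOn_bdry : ∀ α, Set.InjOn (bdry α) (Set.Ico 0 (len α))
  disjoint_bdry : Pairwise fun α β => Disjoint (Set.range (bdry α)) (Set.range (bdry β))
  frontier_domain : frontier domain = ⋃ α, Set.range (bdry α)
  /-- Piecewise smoothness: each curve consists of finitely many arcs, each of them of class `C¹`
  up to its endpoints and parametrized with unit speed. -/
  piecewise_bdry : ∀ α, ∃ (n : ℕ) (t : ℕ → ℝ), t 0 = 0 ∧ t n = len α ∧ ∀ i < n,
    t i < t (i + 1) ∧ ContDiffOn ℝ 1 (bdry α) (Set.Icc (t i) (t (i + 1))) ∧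
      ∀ s ∈ Set.Ioo (t i) (t (i + 1)), ‖deriv (bdry α) s‖ = 1
  /-- Positive orientation: away from the corners the domain lies to the left of the curve,
  and not to the right of it. -/
  oriented_bdry : ∀ α s, ContDiffAt ℝ 1 (bdry α) s → ∀ᶠ ε : ℝ in 𝓝[>] 0,
    bdry α s + ε * (Complex.I * deriv (bdry α) s) ∈ domain ∧
      bdry α s - ε * (Complex.I * deriv (bdry α) s) ∉ domain

namespace BilliardTable

variable {q : ℕ} (T : BilliardTable q)

/-- The coordinates `(α, s, θ)` of phase points: the boundary component `α`, the arclength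
coordinate `0 ≤ s < |∂_α Ω|` of the footpoint, and the angle `0 ≤ θ ≤ π` from the positive tangent
to the outgoing direction. -/
def phaseSet : Set (Fin q × ℝ × ℝ) :=
  {z | z.2.1 ∈ Set.Ico 0 (T.len z.1) ∧ z.2.2 ∈ Set.Icc 0 Real.pi}

/-- The phase space `Φ` of the billiard map. -/
abbrev Phase : Type := T.phaseSet

/-- The Liouville measure `dν = sin θ ds dθ` on the phase space. -/
noncomputable def liouville : Measure T.Phase :=
  Measure.comap Subtype.val
    ((Measure.count.prod (volume.prod volume) : Measure (Fin q × ℝ × ℝ)).withDensity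
      fun z => ENNReal.ofReal (Real.sin z.2.2))

variable {T}

/-- The boundary component containing the footpoint. -/
def Phase.comp (z : T.Phase) : Fin q := z.1.1

/-- The arclength coordinate of the footpoint in its component. -/
def Phase.coord (z : T.Phase) : ℝ := z.1.2.1

/-- The angle of the outgoing direction with the positive tangent. -/
def Phase.angle (z : T.Phase) : ℝ := z.1.2.2

/-- The footpoint `p(z)`. -/
def Phase.foot (z : T.Phase) : ℂ := T.bdry z.comp z.coord

/-- The positive unit tangent vector at the footpoint. -/
noncomputable def Phase.tangent (z : T.Phase) : ℂ := deriv (T.bdry z.comp) z.coord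

/-- The outgoing direction. -/
noncomputable def Phase.dir (z : T.Phase) : ℂ :=
  z.tangent * Complex.exp (z.angle * Complex.I)

/-- The footpoint is not a corner and the outgoing direction is transversal to the boundary. -/
def Phase.Regular (z : T.Phase) : Prop :=
  ContDiffAt ℝ 1 (T.bdry z.comp) z.coord ∧ z.angle ∈ Set.Ioo 0 Real.pi

/-- `w` is the phase point right after the collision that follows `z`: the ball runs inside the
domain from `p(z)` straight to `p(w)`, and there the angle of incidence, which is the angle from
its velocity to the positive tangent, equals the angle of reflection. Neither end is at a corner
or tangential. -/
def Collides (z w : T.Phase) : Prop :=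
  z.Regular ∧ w.Regular ∧
    (∃ t : ℝ, 0 < t ∧ w.foot = z.foot + t * z.dir ∧
      ∀ r ∈ Set.Ioo 0 t, z.foot + (r : ℂ) * z.dir ∈ T.domain) ∧
    z.dir = w.tangent * Complex.exp (-(w.angle * Complex.I))

open Classical in
/-- The billiard map `φ`. It is the collision map where that is defined; elsewhere it has the
placeholder value `z`, and `OrbitDefined` below tells whether this ever happens along an orbit. -/
noncomputable def billiardMap (z : T.Phase) : T.Phase :=
  if h : ∃ w, Collides z w then h.choose else z

/-- All iterates `φᵏ(z)` are defined. -/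
def OrbitDefined (z : T.Phase) : Prop :=
  ∀ k : ℕ, ∃ w, Collides (billiardMap^[k] z) w

variable (T) in
/-- The number `0 ≤ ξ < |∂_α Ω|` with `s + ξ = s'` or `s + ξ = s' + |∂_α Ω|`, for
`0 ≤ s, s' < |∂_α Ω|`. -/
noncomputable def increment (α : Fin q) (s s' : ℝ) : ℝ :=
  if s ≤ s' then s' - s else s' - s + T.len α

/-- The orbit of `z` visits the component `α` at time `k`. -/
def Visits (z : T.Phase) (α : Fin q) (k : ℕ) : Prop := (billiardMap^[k] z).comp = α

noncomputable instance (z : T.Phase) (α : Fin q) : DecidablePred (Visits z α) :=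
  fun _ => inferInstanceAs (Decidable (_ = α))

/-- The arclength coordinate of the `i`-th visit to the component `α` (`i = 0, 1, …`). -/
noncomputable def visitCoord (z : T.Phase) (α : Fin q) (i : ℕ) : ℝ :=
  (billiardMap^[Nat.nth (Visits z α) i] z).coord

/-- The sum `ξ₀ + ⋯ + ξ_{n-1}` over the visits `0 ≤ k₀ < ⋯ < k_n ≤ N` to the component `α`;
it is `0` if there are fewer than two visits. -/
noncomputable def gainSum (z : T.Phase) (α : Fin q) (N : ℕ) : ℝ :=
  ∑ i ∈ Finset.range (Nat.count (Visits z α) (N + 1) - 1),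
    T.increment α (visitCoord z α i) (visitCoord z α (i + 1))

/-- The footpoint gain vector exists at `z`: the orbit of `z` is defined and the limits defining
all the components exist. -/
def GainExists (z : T.Phase) : Prop :=
  OrbitDefined z ∧ ∀ α, ∃ l : ℝ, Tendsto (fun N : ℕ => gainSum z α N / N) atTop (𝓝 l)

open Classical in
/-- The footpoint gain vector, with the placeholder value `0` where it does not exist. -/
noncomputable def footpointGain (z : T.Phase) : Fin q → ℝ :=
  if GainExists z then fun α => limUnder atTop fun N : ℕ => gainSum z α N / N else 0

/-- The rotation vector; it exists where the footpoint gain vector does. -/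
noncomputable def rotationVector (z : T.Phase) : Fin q → ℝ :=
  fun α => footpointGain z α / T.len α

/-- The collision map is single-valued, so that `billiardMap` involves no choice. -/
theorem Collides.unique {z w w' : T.Phase} (h : Collides z w) (h' : Collides z w') : w = w' := by
  obtain ⟨-, ⟨hw, hθ⟩, ⟨t, ht, hf, hd⟩, hv⟩ := h
  obtain ⟨-, ⟨hw', hθ'⟩, ⟨t', ht', hf', hd'⟩, hv'⟩ := h'
  have nmem : ∀ v : T.Phase, v.foot ∉ T.domain := fun v hm => by
    have h1 : v.foot ∈ frontier T.domain := by
      rw [T.frontier_domain]; exact Set.mem_iUnion.2 ⟨_, _, rfl⟩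
    rw [T.isOpen_domain.frontier_eq] at h1
    exact h1.2 hm
  have htt : t = t' := by
    rcases lt_trichotomy t t' with h | h | h
    · exact absurd (hf ▸ hd' t ⟨ht, h⟩) (nmem w)
    · exact h
    · exact absurd (hf' ▸ hd t' ⟨ht', h⟩) (nmem w')
  have hff : w.foot = w'.foot := by rw [hf, hf', htt]
  obtain ⟨⟨α, s, θ⟩, hs, hθ1⟩ := w
  obtain ⟨⟨α', s', θ'⟩, hs', hθ1'⟩ := w'
  simp only [Phase.foot, Phase.comp, Phase.coord, Phase.angle, Phase.tangent] at *
  obtain rfl : α = α' := by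
    by_contra hne
    exact Set.disjoint_left.1 (T.disjoint_bdry hne) ⟨s, rfl⟩ ⟨s', hff.symm⟩
  obtain rfl : s = s' := T.injOn_bdry α hs hs' hff
  have ht0 : deriv (T.bdry α) s ≠ 0 := by
    intro h0
    have := T.oriented_bdry α s hw
    simp only [h0, mul_zero, add_zero, sub_zero] at this
    obtain ⟨ε, h1, h2⟩ := this.exists
    exact h2 h1
  have he := mul_left_cancel₀ ht0 (hv.symm.trans hv')
  have hre := congrArg Complex.re he
  simp only [← neg_mul, ← Complex.ofReal_neg, Complex.exp_ofReal_mul_I_re, Real.cos_neg] at hre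
  obtain rfl : θ = θ' := Real.injOn_cos hθ1 hθ1' hre
  rfl

end BilliardTable

/-! The limit defining each component of the footpoint gain is, up to a null sequence, a limit of
Birkhoff averages. For the function `gain α`, equal at a point on component α to the arclength run
to the next visit there and zero elsewhere, the Birkhoff sum over the times up to N exceeds the sum
of the increments by at most one term, which lies in `[0, T.len α]`. Since `gain α` is bounded by
`T.len α`, existence almost everywhere follows from Birkhoff's theorem for bounded functions, proved
here from the maximal ergodic theorem. Invariance holds because averages of a bounded function at
`z` and at its image differ by a null sequence, and the bounds pass to the limit.

Birkhoff's theorem needs three facts about the billiard map: it is measurable, it is defined almost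
everywhere, and it preserves the Liouville measure. Measurability comes from Lusin–Souslin, because
the collision relation is a Borel set and is single-valued.

Invariance of the measure (`liouville_image`) comes from integral geometry. In terms of the absolute
direction u and the signed offset p of the outgoing ray, sin θ ds dθ becomes dp du, the
motion-invariant measure on oriented lines. A ray and the reversed ray at its next collision carry
the same line with opposite orientations, and reversing orientation preserves dp du. A line may
carry several chords, so phase space is first cut into countably many pieces on which the line
determines the chord (`injOn_line_of_crosses`).

The map is defined almost everywhere (`ae_exists_collides`) because corners and tangential
departures are null, because from each footpoint only one direction aims at a given corner, and
because tangential arrivals are null by a one-dimensional Sard argument in the same line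
coordinates. -/

/-! ### Maximal and pointwise ergodic theorems -/

section Ergodic

variable {X : Type*} {φ : X → X} {g : X → ℝ}

/-- The running maximum `max_{k ≤ n} ∑_{i < k} g (φ^i x)` of the Birkhoff sums. -/
noncomputable def birkhoffMax (φ : X → X) (g : X → ℝ) : ℕ → X → ℝ
  | 0, _ => 0
  | n + 1, x => max 0 (g x + birkhoffMax φ g n (φ x))

theorem birkhoffMax_nonneg (n : ℕ) (x : X) : 0 ≤ birkhoffMax φ g n x := by
  cases n with
  | zero => exact le_rfl
  | succ n => exact le_max_left _ _

theorem birkhoffMax_le_succ (n : ℕ) (x : X) : birkhoffMax φ g n x ≤ birkhoffMax φ g (n + 1) x := by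
  induction n generalizing x with
  | zero => exact birkhoffMax_nonneg 1 x
  | succ n ih => exact max_le_max le_rfl (by simpa using ih (φ x))

theorem birkhoffSum_le_birkhoffMax (n : ℕ) (x : X) : birkhoffSum φ g n x ≤ birkhoffMax φ g n x := by
  induction n generalizing x with
  | zero => simp [birkhoffMax]
  | succ n ih =>
    rw [birkhoffSum_succ']
    exact le_max_of_le_right (by simpa using ih (φ x))

theorem birkhoffMax_eq_zero {B : Set X} (hB : φ ⁻¹' B = B) (hg : ∀ x ∉ B, g x = 0) (n : ℕ) {x : X}
    (hx : x ∉ B) : birkhoffMax φ g n x = 0 := by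
  induction n generalizing x with
  | zero => rfl
  | succ n ih =>
    have hx' : φ x ∉ B := fun h => hx (hB ▸ h)
    simp [birkhoffMax, hg x hx, ih hx']

variable [MeasurableSpace X] {μ : Measure X}

theorem measurable_birkhoffMax (hφ : Measurable φ) (hg : Measurable g) (n : ℕ) :
    Measurable (birkhoffMax φ g n) := by
  induction n with
  | zero => exact measurable_const
  | succ n ih => exact measurable_const.max (hg.add (ih.comp hφ))

theorem integrable_birkhoffMax (hφ : MeasurePreserving φ μ μ) (hg : Integrable g μ) (n : ℕ) :
    Integrable (birkhoffMax φ g n) μ := by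
  induction n with
  | zero => exact integrable_zero _ _ _
  | succ n ih =>
    have h : Integrable (fun x => g x + birkhoffMax φ g n (φ x)) μ :=
      hg.add (hφ.integrable_comp_of_integrable ih)
    exact (integrable_zero X ℝ μ).sup h

/-- The maximal ergodic theorem. -/
theorem setIntegral_birkhoffMax_pos_nonneg (hφ : MeasurePreserving φ μ μ) (hgm : Measurable g)
    (hg : Integrable g μ) (n : ℕ) : 0 ≤ ∫ x in {x | 0 < birkhoffMax φ g (n + 1) x}, g x ∂μ := by
  set E := {x | 0 < birkhoffMax φ g (n + 1) x} with hE
  have hEm : MeasurableSet E :=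
    measurableSet_lt measurable_const (measurable_birkhoffMax hφ.measurable hgm _)
  have hi := integrable_birkhoffMax hφ hg n
  have hic : Integrable (fun x => birkhoffMax φ g n (φ x)) μ := hφ.integrable_comp_of_integrable hi
  have hi' := integrable_birkhoffMax hφ hg (n + 1)
  -- With M n the running maximum, M (n+1) vanishes off E and equals g + M n ∘ φ on E. Hence ∫ M
  -- (n+1) ≤ ∫_E g + ∫ M n ∘ φ = ∫_E g + ∫ M n ≤ ∫_E g + ∫ M (n+1), and the finite integrals cancel.
  have h1 : ∫ x, birkhoffMax φ g (n + 1) x ∂μ = ∫ x in E, birkhoffMax φ g (n + 1) x ∂μ := by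
    refine (setIntegral_eq_integral_of_forall_compl_eq_zero fun x hx => ?_).symm
    exact le_antisymm (not_lt.1 hx) (birkhoffMax_nonneg _ _)
  have h2 : ∫ x in E, birkhoffMax φ g (n + 1) x ∂μ
      = ∫ x in E, (g x + birkhoffMax φ g n (φ x)) ∂μ := by
    refine setIntegral_congr_fun hEm fun x hx => ?_
    have hx : 0 < max 0 (g x + birkhoffMax φ g n (φ x)) := hx
    exact max_eq_right (by by_contra h; simp [max_eq_left (not_le.1 h).le] at hx)
  rw [integral_add hg.integrableOn hic.integrableOn] at h2
  have h3 : ∫ x in E, birkhoffMax φ g n (φ x) ∂μ ≤ ∫ x, birkhoffMax φ g n (φ x) ∂μ :=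
    setIntegral_le_integral hic (Eventually.of_forall fun x => birkhoffMax_nonneg _ _)
  have h4 : ∫ x, birkhoffMax φ g n (φ x) ∂μ = ∫ x, birkhoffMax φ g n x ∂μ := by
    rw [← integral_map hφ.measurable.aemeasurable, hφ.map_eq]
    rw [hφ.map_eq]; exact hi.aestronglyMeasurable
  have h5 : ∫ x, birkhoffMax φ g n x ∂μ ≤ ∫ x, birkhoffMax φ g (n + 1) x ∂μ :=
    integral_mono hi hi' fun x => birkhoffMax_le_succ n x
  linarith

/-- Cutting g off outside the invariant set B does not change its Birkhoff sums on B. The sets where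
the running maximum of the cut-off function is positive then increase exactly to B, and the maximal
inequality passes to the limit. -/
theorem setIntegral_nonneg_of_birkhoffSum_pos (hφ : MeasurePreserving φ μ μ) (hgm : Measurable g)
    (hg : Integrable g μ) {B : Set X} (hBm : MeasurableSet B) (hB : φ ⁻¹' B = B)
    (hpos : ∀ x ∈ B, ∃ k, 0 < birkhoffSum φ g k x) : 0 ≤ ∫ x in B, g x ∂μ := by
  set G := B.indicator g with hG
  have hGm : Measurable G := hgm.indicator hBm
  have hGi : Integrable G μ := hg.indicator hBm
  have hit : ∀ n : ℕ, ∀ x ∈ B, φ^[n] x ∈ B := fun n => by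
    induction n with
    | zero => exact fun x hx => hx
    | succ n ih => exact fun x hx => ih _ (by rw [← hB] at hx; exact hx)
  have hsum : ∀ x ∈ B, ∀ k, birkhoffSum φ G k x = birkhoffSum φ g k x := fun x hx k =>
    Finset.sum_congr rfl fun i _ => Set.indicator_of_mem (hit i x hx) g
  set E : ℕ → Set X := fun n => {x | 0 < birkhoffMax φ G (n + 1) x} with hE
  have hmono : Monotone E := monotone_nat_of_le_succ fun n x hx =>
    lt_of_lt_of_le hx (birkhoffMax_le_succ _ _)
  have hEm : ∀ n, MeasurableSet (E n) := fun n =>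
    measurableSet_lt measurable_const (measurable_birkhoffMax hφ.measurable hGm _)
  have hU : ⋃ n, E n = B := by
    ext x
    simp only [Set.mem_iUnion]
    refine ⟨fun ⟨n, hn⟩ => ?_, fun hx => ?_⟩
    · by_contra hx
      have hn : 0 < birkhoffMax φ G (n + 1) x := hn
      rw [birkhoffMax_eq_zero hB (fun y hy => Set.indicator_of_notMem hy g) _ hx] at hn
      exact lt_irrefl _ hn
    · obtain ⟨k, hk⟩ := hpos x hx
      rw [← hsum x hx] at hk
      exact ⟨k, hk.trans_le ((birkhoffSum_le_birkhoffMax k x).trans (birkhoffMax_le_succ k x))⟩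
  have hlim := tendsto_setIntegral_of_monotone hEm hmono (hU ▸ hGi.integrableOn : IntegrableOn G _ μ)
  have h0 := ge_of_tendsto' hlim fun n => setIntegral_birkhoffMax_pos_nonneg hφ hGm hGi n
  rw [hU] at h0
  rwa [setIntegral_congr_fun hBm fun x hx => Set.indicator_of_mem hx g] at h0

theorem measurable_birkhoffAverage (hφ : Measurable φ) (hg : Measurable g) (n : ℕ) :
    Measurable (birkhoffAverage ℝ φ g n) := by
  have : Measurable fun x => ∑ k ∈ Finset.range n, g (φ^[k] x) :=
    Finset.measurable_fun_sum _ fun k _ => hg.comp (hφ.iterate k)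
  exact this.const_mul (n : ℝ)⁻¹

theorem measurableSet_frequently {p : ℕ → X → Prop} (hp : ∀ n, MeasurableSet {x | p n x}) :
    MeasurableSet {x | ∃ᶠ n in atTop, p n x} := by
  simp only [frequently_atTop, Set.ofPred_forall, Set.ofPred_exists]
  exact .iInter fun N => .iUnion fun n => .inter (.const _) (hp n)

/-- Averages oscillate across `[a, b]` on a null set only. -/
theorem measure_upcrossing_birkhoffAverage_eq_zero [IsFiniteMeasure μ]
    (hφ : MeasurePreserving φ μ μ) (hgm : Measurable g) {C : ℝ} (hC : ∀ x, |g x| ≤ C) {a b : ℝ}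
    (hab : a < b) : μ {x | (∃ a' : ℚ, (a' : ℝ) < a ∧ ∃ᶠ n in atTop, birkhoffAverage ℝ φ g n x < a') ∧
      ∃ b' : ℚ, b < b' ∧ ∃ᶠ n in atTop, (b' : ℝ) < birkhoffAverage ℝ φ g n x} = 0 := by
  set B := {x | (∃ a' : ℚ, (a' : ℝ) < a ∧ ∃ᶠ n in atTop, birkhoffAverage ℝ φ g n x < a') ∧
      ∃ b' : ℚ, b < b' ∧ ∃ᶠ n in atTop, (b' : ℝ) < birkhoffAverage ℝ φ g n x} with hBdef
  have hA := measurable_birkhoffAverage hφ.measurable hgm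
  have hgi : Integrable g μ := Integrable.of_bound hgm.aestronglyMeasurable C
    (Eventually.of_forall fun x => by simpa using hC x)
  have hBm : MeasurableSet B := by
    simp only [hBdef, Set.ofPred_and, Set.ofPred_exists]
    refine .inter (.iUnion fun a' => .inter (.const _) ?_) (.iUnion fun b' => .inter (.const _) ?_)
    · exact measurableSet_frequently fun n => measurableSet_lt (hA n) measurable_const
    · exact measurableSet_frequently fun n => measurableSet_lt measurable_const (hA n)
  have hbdd : Bornology.IsBounded (Set.range g) := by
    refine (Metric.isBounded_closedBall (x := (0 : ℝ)) (r := C)).subset ?_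
    rintro _ ⟨x, rfl⟩
    simpa using hC x
  have hdiff : ∀ x, Tendsto (fun n => birkhoffAverage ℝ φ g n (φ x) - birkhoffAverage ℝ φ g n x)
      atTop (𝓝 0) := tendsto_birkhoffAverage_apply_sub_birkhoffAverage' ℝ hbdd φ
  -- The averages at x and at φ x differ by a null sequence. The slack in a' < a and b < b' absorbs
  -- it, so B is exactly invariant and not only almost so.
  have key : ∀ u v : ℕ → ℝ, Tendsto (fun n => u n - v n) atTop (𝓝 0) →
      ((∃ a' : ℚ, (a' : ℝ) < a ∧ ∃ᶠ n in atTop, u n < a') ∧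
        ∃ b' : ℚ, b < b' ∧ ∃ᶠ n in atTop, (b' : ℝ) < u n) →
      ((∃ a' : ℚ, (a' : ℝ) < a ∧ ∃ᶠ n in atTop, v n < a') ∧
        ∃ b' : ℚ, b < b' ∧ ∃ᶠ n in atTop, (b' : ℝ) < v n) := by
    rintro u v huv ⟨⟨a', ha', hu⟩, b', hb', hv⟩
    obtain ⟨a'', h1, h2⟩ := exists_rat_btwn ha'
    obtain ⟨b'', h3, h4⟩ := exists_rat_btwn hb'
    refine ⟨⟨a'', h2, ?_⟩, b'', h3, ?_⟩
    · refine (hu.and_eventually (huv.eventually_const_lt (sub_neg.2 h1))).mono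
        fun n hn => by linarith [hn.1, hn.2]
    · refine (hv.and_eventually (huv.eventually_lt_const (sub_pos.2 h4))).mono
        fun n hn => by linarith [hn.1, hn.2]
  have hinv : φ ⁻¹' B = B := by
    ext x
    refine ⟨key _ _ (hdiff x), key _ _ ?_⟩
    simpa using (hdiff x).neg
  have hsumb : ∀ (c : ℝ) (k : ℕ) (x : X), birkhoffSum φ (fun y => g y - c) k x
      = birkhoffSum φ g k x - k * c := fun c k x => by
    simp [birkhoffSum, Finset.sum_sub_distrib]
  have hsuma : ∀ (c : ℝ) (k : ℕ) (x : X), birkhoffSum φ (fun y => c - g y) k x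
      = k * c - birkhoffSum φ g k x := fun c k x => by
    simp [birkhoffSum, Finset.sum_sub_distrib]
  have h1 : 0 ≤ ∫ x in B, (g x - b) ∂μ := by
    refine setIntegral_nonneg_of_birkhoffSum_pos hφ (hgm.sub_const b)
      (hgi.sub (integrable_const b)) hBm hinv ?_
    rintro x ⟨-, b', hb', hx⟩
    obtain ⟨k, hk, hk0⟩ := (hx.and_eventually (eventually_gt_atTop 0)).exists
    refine ⟨k, ?_⟩
    have hk0' : (0 : ℝ) < k := by exact_mod_cast hk0
    rw [birkhoffAverage, smul_eq_mul, lt_inv_mul_iff₀ hk0'] at hk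
    rw [hsumb]
    nlinarith
  have h2 : 0 ≤ ∫ x in B, (a - g x) ∂μ := by
    refine setIntegral_nonneg_of_birkhoffSum_pos hφ (hgm.const_sub a)
      ((integrable_const a).sub hgi) hBm hinv ?_
    rintro x ⟨⟨a', ha', hx⟩, -⟩
    obtain ⟨k, hk, hk0⟩ := (hx.and_eventually (eventually_gt_atTop 0)).exists
    refine ⟨k, ?_⟩
    have hk0' : (0 : ℝ) < k := by exact_mod_cast hk0
    rw [birkhoffAverage, smul_eq_mul, inv_mul_lt_iff₀ hk0'] at hk
    rw [hsuma]
    nlinarith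
  rw [integral_sub hgi.integrableOn (integrable_const _).integrableOn] at h1
  rw [integral_sub (integrable_const _).integrableOn hgi.integrableOn] at h2
  simp only [setIntegral_const, smul_eq_mul] at h1 h2
  -- The two integral inequalities read b μ(B) ≤ ∫_B g ≤ a μ(B), while a < b.
  have h3 : μ.real B = 0 := by
    have := measureReal_nonneg (μ := μ) (s := B)
    nlinarith
  exact (measureReal_eq_zero_iff (measure_ne_top μ B)).1 h3

/-- Birkhoff's pointwise ergodic theorem: the averages of a bounded function converge almost
everywhere. -/
theorem ae_exists_tendsto_birkhoffAverage [IsFiniteMeasure μ] (hφ : MeasurePreserving φ μ μ)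
    (hgm : Measurable g) {C : ℝ} (hC : ∀ x, |g x| ≤ C) :
    ∀ᵐ x ∂μ, ∃ l, Tendsto (fun n => birkhoffAverage ℝ φ g n x) atTop (𝓝 l) := by
  have h : ∀ a b : ℚ, a < b → ∀ᵐ x ∂μ,
      ¬ ((∃ a' : ℚ, (a' : ℝ) < a ∧ ∃ᶠ n in atTop, birkhoffAverage ℝ φ g n x < a') ∧
      ∃ b' : ℚ, (b : ℝ) < b' ∧ ∃ᶠ n in atTop, (b' : ℝ) < birkhoffAverage ℝ φ g n x) := fun a b hab => by
    rw [ae_iff]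
    simp only [not_not]
    exact measure_upcrossing_birkhoffAverage_eq_zero hφ hgm hC (by exact_mod_cast hab)
  have h' : ∀ᵐ x ∂μ, ∀ a b : ℚ, a < b →
      ¬ ((∃ a' : ℚ, (a' : ℝ) < a ∧ ∃ᶠ n in atTop, birkhoffAverage ℝ φ g n x < a') ∧
      ∃ b' : ℚ, (b : ℝ) < b' ∧ ∃ᶠ n in atTop, (b' : ℝ) < birkhoffAverage ℝ φ g n x) := by
    simpa only [ae_all_iff] using h
  filter_upwards [h'] with x hx
  have hbd : ∀ n, |birkhoffAverage ℝ φ g n x| ≤ C := fun n => by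
    rcases Nat.eq_zero_or_pos n with rfl | hn
    · simpa using (abs_nonneg _).trans (hC x)
    · have hn' : (0 : ℝ) < n := by exact_mod_cast hn
      rw [birkhoffAverage, smul_eq_mul, abs_mul, abs_of_pos (inv_pos.2 hn'), inv_mul_le_iff₀ hn']
      refine (Finset.abs_sum_le_sum_abs _ _).trans ?_
      refine (Finset.sum_le_sum fun i _ => hC (φ^[i] x)).trans ?_
      simp
  refine tendsto_of_no_upcrossings (s := Set.range ((↑) : ℚ → ℝ)) Rat.denseRange_cast ?_
    (isBoundedUnder_of ⟨C, fun n => (abs_le.1 (hbd n)).2⟩)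
    (isBoundedUnder_of ⟨-C, fun n => (abs_le.1 (hbd n)).1⟩)
  rintro _ ⟨a, rfl⟩ _ ⟨b, rfl⟩ hab ⟨ha, hb⟩
  have hab' : a < b := by exact_mod_cast hab
  -- The levels are shrunk to a < c < d < b so that a and b themselves serve as the strict rational
  -- witnesses for the pair c, d.
  obtain ⟨c, h1, h2⟩ := exists_between hab'
  obtain ⟨d, h3, h4⟩ := exists_between h2
  exact hx c d h3 ⟨⟨a, by exact_mod_cast h1, ha⟩, b, by exact_mod_cast h4, hb⟩

end Ergodic

/-! ### Enumerating the elements of a set of times -/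

/-- `Nat.nth p n` is 0 when a finite set has no n-th element; this excludes the default. -/
theorem Nat.lt_card_of_lt_count {p : ℕ → Prop} [DecidablePred p] {n N : ℕ}
    (h : n < Nat.count p N) (hf : (Set.ofPred p).Finite) : n < hf.toFinset.card :=
  h.trans_le (by
    rw [Nat.count_eq_card_filter_range]
    exact Finset.card_le_card fun x hx => hf.mem_toFinset.2 (Finset.mem_filter.1 hx).2)

/-- Both sides are the second element at or after k. When p k holds, this is the next element after
k, seen from time k. -/
theorem Nat.nth_add_one_of_count {p : ℕ → Prop} [DecidablePred p] {k N : ℕ}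
    (hN : Nat.count p k + 1 < Nat.count p (N + 1)) :
    Nat.nth p (Nat.count p k + 1) = k + Nat.nth (fun j => p (k + j)) 1 := by
  set m := Nat.nth p (Nat.count p k + 1) with hm
  have hc : ∀ hf : (Set.ofPred p).Finite, Nat.count p k + 1 < hf.toFinset.card :=
    Nat.lt_card_of_lt_count hN
  have hpm : p m := Nat.nth_mem _ hc
  have hcm : Nat.count p m = Nat.count p k + 1 := Nat.count_nth hc
  have hkm : k < m := by
    by_contra h
    have := Nat.count_monotone p (not_lt.1 h)
    omega
  obtain ⟨j, hj⟩ := Nat.exists_eq_add_of_lt hkm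
  rw [hj] at hcm hpm
  rw [hj]
  have h1 : Nat.count (fun i => p (k + i)) (j + 1) = 1 := by
    have := Nat.count_add p k (j + 1)
    rw [show k + (j + 1) = k + j + 1 by ring, hcm] at this
    omega
  have h2 := Nat.nth_count (p := fun i => p (k + i)) (n := j + 1) hpm
  rw [h1] at h2
  rw [h2]
  rfl

/-- Expresses `Nat.nth` through counts alone, as needed for measurability; the second alternative is
the default value 0. -/
theorem Nat.nth_eq_iff {p : ℕ → Prop} [DecidablePred p] {n k : ℕ} :
    Nat.nth p n = k ↔ (p k ∧ Nat.count p k = n) ∨ (k = 0 ∧ ∀ j, ¬ (p j ∧ Nat.count p j = n)) := by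
  by_cases h : ∀ hf : (Set.ofPred p).Finite, n < hf.toFinset.card
  · refine ⟨?_, ?_⟩
    · rintro rfl
      exact .inl ⟨Nat.nth_mem _ h, Nat.count_nth h⟩
    · rintro (⟨h1, rfl⟩ | ⟨-, h2⟩)
      · exact Nat.nth_count h1
      · exact absurd ⟨Nat.nth_mem _ h, Nat.count_nth h⟩ (h2 _)
  · have h0 : ∀ j, ¬ (p j ∧ Nat.count p j = n) := by
      rintro j ⟨hj, rfl⟩
      push Not at h
      obtain ⟨hf, hle⟩ := h
      have := Nat.lt_card_of_lt_count (p := p) (n := Nat.count p j) (N := j + 1)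
        (by simp [Nat.count_succ, hj]) hf
      omega
    push Not at h
    obtain ⟨hf, hle⟩ := h
    rw [Nat.nth_of_card_le hf hle]
    exact ⟨fun h => .inr ⟨h.symm, h0⟩, fun h => h.elim (fun h => absurd h (h0 _)) fun h => h.1.symm⟩

/-- The position of the `n`-th element of a random set of naturals is measurable. -/
theorem measurable_nth {X : Type*} [MeasurableSpace X] {p : X → ℕ → Prop}
    [∀ x, DecidablePred (p x)] (hp : ∀ k, MeasurableSet {x | p x k}) (n : ℕ) :
    Measurable fun x => Nat.nth (p x) n := by
  have hc : ∀ k m, MeasurableSet {x | Nat.count (p x) k = m} := fun k => by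
    induction k with
    | zero => exact fun m => by simp
    | succ k ih =>
      intro m
      have : {x | Nat.count (p x) (k + 1) = m} = ({x | p x k} ∩ {x | ∃ l, l + 1 = m ∧ Nat.count (p x) k = l})
          ∪ ({x | p x k}ᶜ ∩ {x | Nat.count (p x) k = m}) := by
        ext x
        by_cases hx : p x k <;> simp [Nat.count_succ, hx, eq_comm]
      rw [this]
      refine .union (.inter (hp k) ?_) (.inter (hp k).compl (ih m))
      simp only [Set.ofPred_exists]
      exact .iUnion fun l => .inter (.const _) (ih l)
  refine measurable_to_countable' fun k => ?_
  have : (fun x => Nat.nth (p x) n) ⁻¹' {k} = ({x | p x k} ∩ {x | Nat.count (p x) k = n}) ∪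
      {x | k = 0 ∧ ∀ j, ¬ (p x j ∧ Nat.count (p x) j = n)} := by
    ext x
    exact Nat.nth_eq_iff
  rw [this]
  refine .union (.inter (hp k) (hc k n)) (.inter (.const _) ?_)
  change MeasurableSet {x | ∀ j, ¬ (p x j ∧ Nat.count (p x) j = n)}
  rw [Set.ofPred_forall]
  exact .iInter fun j => (.compl (.inter (hp j) (hc j n)))

/-! ### The footpoint gain as a Birkhoff average -/

namespace BilliardTable

variable {q : ℕ} {T : BilliardTable q}

theorem billiardMap_of_collides {z w : T.Phase} (h : Collides z w) : billiardMap z = w := by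
  have hex : ∃ w, Collides z w := ⟨w, h⟩
  rw [billiardMap, dif_pos hex]
  exact hex.choose_spec.unique h

theorem billiardMap_of_not_collides {z : T.Phase} (h : ¬ ∃ w, Collides z w) :
    billiardMap z = z := dif_neg h

/-- Where no collision follows, the placeholder value is z itself and the claim is trivial. For this
reason invariance can be stated at every phase point. -/
theorem orbitDefined_billiardMap_iff (z : T.Phase) :
    OrbitDefined (billiardMap z) ↔ OrbitDefined z := by
  by_cases h : ∃ w, Collides z w
  · refine ⟨fun H k => ?_, fun H k => ?_⟩
    · cases k with
      | zero => exact h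
      | succ k => exact H k
    · exact H (k + 1)
  · rw [billiardMap_of_not_collides h]

variable (T) in
theorem increment_mem {α : Fin q} {s s' : ℝ} (hs : s ∈ Set.Ico 0 (T.len α))
    (hs' : s' ∈ Set.Ico 0 (T.len α)) : T.increment α s s' ∈ Set.Icc 0 (T.len α) := by
  obtain ⟨h1, h2⟩ := hs
  obtain ⟨h3, h4⟩ := hs'
  unfold increment
  split_ifs <;> constructor <;> linarith

/-- The footpoint gain on the component `α` from `z` to the next visit: zero when `z` is not on
this component or there is no further visit. -/
noncomputable def gain (α : Fin q) (z : T.Phase) : ℝ :=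
  if z.comp = α then T.increment α (visitCoord z α 0) (visitCoord z α 1) else 0

theorem visitCoord_zero {z : T.Phase} {α : Fin q} (h : z.comp = α) :
    visitCoord z α 0 = z.coord := by
  have : Nat.nth (Visits z α) 0 = 0 := Nat.nth_zero_of_zero h
  simp [visitCoord, this]

/-- If there is no second visit, `Nat.nth` gives time 0, and the point visited is z itself, still on
the component. -/
theorem visitCoord_one_mem {z : T.Phase} {α : Fin q} (h : z.comp = α) :
    visitCoord z α 1 ∈ Set.Ico 0 (T.len α) := by
  have h1 : (billiardMap^[Nat.nth (Visits z α) 1] z).comp = α := by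
    by_cases hf : ∀ hf : (Set.ofPred (Visits z α)).Finite, 1 < hf.toFinset.card
    · exact Nat.nth_mem (p := Visits z α) 1 hf
    · push Not at hf
      obtain ⟨hf, hle⟩ := hf
      rw [Nat.nth_of_card_le hf hle]
      exact h
  have := (billiardMap^[Nat.nth (Visits z α) 1] z).2.1
  rwa [show (billiardMap^[Nat.nth (Visits z α) 1] z).1.1 = α from h1] at this

theorem gain_mem (α : Fin q) (z : T.Phase) : gain α z ∈ Set.Icc 0 (T.len α) := by
  unfold gain
  split_ifs with h
  · refine T.increment_mem ?_ (visitCoord_one_mem h)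
    rw [visitCoord_zero h]
    have := z.2.1
    rwa [show z.1.1 = α from h] at this
  · exact ⟨le_rfl, (T.len_pos α).le⟩

theorem birkhoffSum_gain (z : T.Phase) (α : Fin q) (N : ℕ) :
    birkhoffSum billiardMap (gain α) N z =
      ∑ i ∈ Finset.range (Nat.count (Visits z α) N),
        gain α (billiardMap^[Nat.nth (Visits z α) i] z) := by
  induction N with
  | zero => simp
  | succ N ih =>
    rw [birkhoffSum_succ, ih, Nat.count_succ]
    split_ifs with h
    · rw [Finset.sum_range_succ, Nat.nth_count h]
    · have : gain α (billiardMap^[N] z) = 0 := if_neg h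
      rw [this, add_zero, add_zero]

/-- Restarting the orbit at its i-th visit shifts the visiting times, so visit i + 1 becomes the
visit with index 1. The hypothesis ensures that visit i + 1 really occurs. -/
theorem gain_iterate_nth {z : T.Phase} {α : Fin q} {N i : ℕ}
    (hi : i + 1 < Nat.count (Visits z α) (N + 1)) :
    gain α (billiardMap^[Nat.nth (Visits z α) i] z) =
      T.increment α (visitCoord z α i) (visitCoord z α (i + 1)) := by
  have hc : ∀ hf : (Set.ofPred (Visits z α)).Finite, i < hf.toFinset.card :=
    Nat.lt_card_of_lt_count (Nat.lt_of_succ_lt hi)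
  set k := Nat.nth (Visits z α) i with hk
  have hpk : Visits z α k := Nat.nth_mem _ hc
  have hck : Nat.count (Visits z α) k = i := Nat.count_nth hc
  have hnext := Nat.nth_add_one_of_count (hck.symm ▸ hi)
  rw [hck] at hnext
  have hshift : Visits (billiardMap^[k] z) α = fun j => Visits z α (k + j) := by
    funext j
    unfold Visits
    rw [add_comm, Function.iterate_add_apply]
  rw [gain, if_pos (show (billiardMap^[k] z).comp = α from hpk), visitCoord_zero hpk]
  congr 1
  rw [visitCoord, visitCoord, hnext, ← Function.iterate_add_apply, hshift, add_comm]

/-- The Birkhoff sum has one term for each visit up to time N, the increment sum one for each pair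
of consecutive visits. The extra term is the gain at the last visit, which lies between 0 and the
length. -/
theorem gainSum_mem (z : T.Phase) (α : Fin q) (N : ℕ) :
    gainSum z α N ≤ birkhoffSum billiardMap (gain α) (N + 1) z ∧
      birkhoffSum billiardMap (gain α) (N + 1) z ≤ gainSum z α N + T.len α := by
  rw [birkhoffSum_gain, gainSum]
  obtain h | ⟨m, hm⟩ : Nat.count (Visits z α) (N + 1) = 0 ∨ ∃ m, Nat.count (Visits z α) (N + 1) = m + 1 :=
    (Nat.eq_zero_or_eq_succ_pred _).imp id fun h => ⟨_, h⟩
  · simp [h, (T.len_pos α).le]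
  · rw [hm, Nat.add_sub_cancel, Finset.sum_range_succ, Finset.sum_congr rfl fun i hi =>
      gain_iterate_nth (N := N) (by rw [hm]; simpa using Finset.mem_range.1 hi)]
    have := gain_mem α (billiardMap^[Nat.nth (Visits z α) m] z)
    constructor <;> linarith [this.1, this.2]

theorem birkhoffSum_gain_mem (z : T.Phase) (α : Fin q) (N : ℕ) :
    birkhoffSum billiardMap (gain α) N z ∈ Set.Icc 0 (N * T.len α) := by
  refine ⟨Finset.sum_nonneg fun i _ => (gain_mem _ _).1, ?_⟩
  exact (Finset.sum_le_sum fun i _ => (gain_mem α _).2).trans (by simp)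

/-- The averages defining the footpoint gain agree with Birkhoff averages up to a null sequence. -/
theorem tendsto_gainSum_div_sub (z : T.Phase) (α : Fin q) :
    Tendsto (fun N : ℕ => gainSum z α N / N - birkhoffAverage ℝ billiardMap (gain α) N z) atTop
      (𝓝 0) := by
  have h0 : Tendsto (fun N : ℕ => T.len α / (N : ℝ)) atTop (𝓝 0) :=
    tendsto_const_nhds.div_atTop tendsto_natCast_atTop_atTop
  refine squeeze_zero_norm (fun N => ?_) h0
  have h1 := gainSum_mem z α N
  -- `gainSum` counts the N + 1 times up to N but is divided by N; the term at time N is split off,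
  -- and the total error stays within one length.
  rw [birkhoffSum_succ] at h1
  have h2 := gain_mem α (billiardMap^[N] z)
  rw [birkhoffAverage, smul_eq_mul, ← div_eq_inv_mul, ← sub_div, Real.norm_eq_abs, abs_div,
    Nat.abs_cast]
  gcongr
  rw [abs_le]
  constructor <;> linarith [h1.1, h1.2, h2.1, h2.2]

theorem tendsto_gainSum_div_iff {z : T.Phase} {α : Fin q} {l : ℝ} :
    Tendsto (fun N : ℕ => gainSum z α N / N) atTop (𝓝 l) ↔
      Tendsto (fun N : ℕ => birkhoffAverage ℝ billiardMap (gain α) N z) atTop (𝓝 l) := by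
  have h := tendsto_gainSum_div_sub z α
  exact ⟨fun H => by simpa using H.sub h, fun H => by simpa using h.add H⟩

theorem tendsto_gainSum_billiardMap_iff {z : T.Phase} {α : Fin q} {l : ℝ} :
    Tendsto (fun N : ℕ => gainSum (billiardMap z) α N / N) atTop (𝓝 l) ↔
      Tendsto (fun N : ℕ => gainSum z α N / N) atTop (𝓝 l) := by
  rw [tendsto_gainSum_div_iff, tendsto_gainSum_div_iff]
  have hb : Bornology.IsBounded (Set.range (gain (T := T) α)) :=
    (Metric.isBounded_Icc 0 (T.len α)).subset (Set.range_subset_iff.2 (gain_mem α))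
  have h := tendsto_birkhoffAverage_apply_sub_birkhoffAverage' ℝ hb billiardMap z
  exact ⟨fun H => by simpa using H.sub h, fun H => by simpa using h.add H⟩

theorem gainExists_billiardMap_iff (z : T.Phase) :
    GainExists (billiardMap z) ↔ GainExists z := by
  unfold GainExists
  simp only [orbitDefined_billiardMap_iff, tendsto_gainSum_billiardMap_iff]

theorem tendsto_footpointGain {z : T.Phase} (h : GainExists z) (α : Fin q) :
    Tendsto (fun N : ℕ => gainSum z α N / N) atTop (𝓝 (footpointGain z α)) := by
  rw [footpointGain, if_pos h]
  exact tendsto_nhds_limUnder (h.2 α)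

theorem footpointGain_billiardMap (z : T.Phase) :
    footpointGain (billiardMap z) = footpointGain z := by
  by_cases h : GainExists z
  · funext α
    exact tendsto_nhds_unique (tendsto_footpointGain ((gainExists_billiardMap_iff z).2 h) α)
      (tendsto_gainSum_billiardMap_iff.2 (tendsto_footpointGain h α))
  · rw [footpointGain, footpointGain, if_neg h, if_neg (fun h' => h ((gainExists_billiardMap_iff z).1 h'))]

theorem footpointGain_mem (z : T.Phase) (α : Fin q) :
    footpointGain z α ∈ Set.Icc 0 (T.len α) := by
  by_cases h : GainExists z
  · refine isClosed_Icc.mem_of_tendsto (tendsto_gainSum_div_iff.1 (tendsto_footpointGain h α))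
      ((eventually_gt_atTop 0).mono fun N hN => ?_)
    have hN' : (0 : ℝ) < N := by exact_mod_cast hN
    have := birkhoffSum_gain_mem z α N
    rw [birkhoffAverage, smul_eq_mul]
    exact ⟨by have := this.1; positivity, by rw [inv_mul_le_iff₀ hN']; exact this.2⟩
  · rw [footpointGain, if_neg h]
    exact ⟨le_rfl, (T.len_pos α).le⟩

theorem measurable_comp : Measurable (Phase.comp (T := T)) :=
  measurable_fst.comp measurable_subtype_coe

theorem measurable_coord : Measurable (Phase.coord (T := T)) :=
  measurable_fst.comp (measurable_snd.comp measurable_subtype_coe)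

theorem measurable_angle : Measurable (Phase.angle (T := T)) :=
  measurable_snd.comp (measurable_snd.comp measurable_subtype_coe)

/-- The visiting time is a measurable random integer, and evaluating the orbit at an integer time is
jointly measurable because ℕ is countable. -/
theorem measurable_visitCoord (hφ : Measurable (billiardMap (T := T))) (α : Fin q) (i : ℕ) :
    Measurable fun z : T.Phase => visitCoord z α i := by
  have hn : Measurable fun z : T.Phase => Nat.nth (Visits z α) i := measurable_nth (fun k =>
    (measurable_comp.comp (hφ.iterate k)) (measurableSet_singleton α)) i
  have h2 : Measurable fun x : T.Phase × ℕ => (billiardMap^[x.2] x.1).coord :=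
    measurable_from_prod_countable_left fun k => measurable_coord.comp (hφ.iterate k)
  exact h2.comp (measurable_id.prodMk hn)

theorem measurable_gain (hφ : Measurable (billiardMap (T := T))) (α : Fin q) :
    Measurable (gain (T := T) α) := by
  have h0 := measurable_visitCoord hφ α 0
  have h1 := measurable_visitCoord hφ α 1
  refine Measurable.ite (measurable_comp (measurableSet_singleton α)) ?_ measurable_const
  exact Measurable.ite (measurableSet_le h0 h1) (h1.sub h0) ((h1.sub h0).add_const _)

theorem measurableSet_gainExists (hφ : Measurable (billiardMap (T := T)))
    (hD : MeasurableSet {z : T.Phase | ∃ w, Collides z w}) :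
    MeasurableSet {z : T.Phase | GainExists z} := by
  simp only [GainExists, OrbitDefined, tendsto_gainSum_div_iff, Set.ofPred_and, Set.ofPred_forall]
  refine .inter (.iInter fun k => (hφ.iterate k) hD) (.iInter fun α => ?_)
  exact measurableSet_exists_tendsto fun n => measurable_birkhoffAverage hφ (measurable_gain hφ α) n

theorem measurable_footpointGain (hφ : Measurable (billiardMap (T := T)))
    (hD : MeasurableSet {z : T.Phase | ∃ w, Collides z w}) :
    Measurable (footpointGain (T := T)) := by
  classical
  have hE := measurableSet_gainExists hφ hD
  refine measurable_pi_lambda _ fun α => ?_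
  refine measurable_of_tendsto_metrizable (f := fun (N : ℕ) (z : T.Phase) =>
    if GainExists z then birkhoffAverage ℝ billiardMap (gain α) N z else 0) (fun N =>
      Measurable.ite hE (measurable_birkhoffAverage hφ (measurable_gain hφ α) N) measurable_const) ?_
  refine tendsto_pi_nhds.2 fun z => ?_
  by_cases h : GainExists z
  · simpa only [if_pos h] using tendsto_gainSum_div_iff.1 (tendsto_footpointGain h α)
  · simp [footpointGain, h]

theorem ae_gainExists [IsFiniteMeasure T.liouville]
    (hφ : MeasurePreserving billiardMap T.liouville T.liouville)
    (hD : ∀ᵐ z ∂T.liouville, ∃ w, Collides z w) : ∀ᵐ z ∂T.liouville, GainExists z := by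
  have h1 : ∀ᵐ z ∂T.liouville, OrbitDefined z := ae_all_iff.2 fun k =>
    (hφ.iterate k).quasiMeasurePreserving.ae hD
  have h2 : ∀ᵐ z ∂T.liouville, ∀ α, ∃ l, Tendsto
      (fun N : ℕ => birkhoffAverage ℝ billiardMap (gain α) N z) atTop (𝓝 l) := ae_all_iff.2 fun α =>
    ae_exists_tendsto_birkhoffAverage hφ (measurable_gain hφ.measurable α) (C := T.len α) fun z => by
      rw [abs_of_nonneg (gain_mem α z).1]
      exact (gain_mem α z).2
  filter_upwards [h1, h2] with z hz1 hz2
  refine ⟨hz1, fun α => ?_⟩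
  simpa only [tendsto_gainSum_div_iff] using hz2 α

end BilliardTable

/-! ### Local geometry of the boundary, first hits and time reversal -/

namespace BilliardTable

variable {q : ℕ} {T : BilliardTable q}

variable (T) in
/-- Arcs: all but finitely many parameters are smooth, and to the right of any parameter the
parametrization has unit speed for a while. -/
theorem exists_finset_corners (α : Fin q) : ∃ F : Finset ℝ, ∀ s ∈ Set.Ico 0 (T.len α),
    (s ∉ F → ContDiffAt ℝ 1 (T.bdry α) s) ∧ ∀ᶠ s' in 𝓝[>] s, ‖deriv (T.bdry α) s'‖ = 1 := by
  obtain ⟨n, t, h0, hn, h⟩ := T.piecewise_bdry α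
  refine ⟨(Finset.range n).image t, fun s hs => ?_⟩
  have hex : ∃ i < n, s ∈ Set.Ico (t i) (t (i + 1)) := by
    have hind : ∀ m ≤ n, s < t m → ∃ i < m, s ∈ Set.Ico (t i) (t (i + 1)) := fun m => by
      induction m with
      | zero => exact fun _ hm => absurd hm (not_lt.2 (h0 ▸ hs.1))
      | succ m ih =>
        intro hm hsm
        by_cases hc : s < t m
        · obtain ⟨i, hi, h'⟩ := ih (by omega) hc
          exact ⟨i, by omega, h'⟩
        · exact ⟨m, by omega, not_lt.1 hc, hsm⟩
    exact hind n le_rfl (hn ▸ hs.2)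
  obtain ⟨i, hi, hsi⟩ := hex
  obtain ⟨-, h1, h2⟩ := h i hi
  refine ⟨fun hF => ?_, ?_⟩
  · have hne : t i ≠ s := fun he => hF (Finset.mem_image.2 ⟨i, Finset.mem_range.2 hi, he⟩)
    exact h1.contDiffAt (Icc_mem_nhds (lt_of_le_of_ne hsi.1 hne) hsi.2)
  · filter_upwards [Ioo_mem_nhdsGT hsi.2] with s' hs'
    exact h2 s' ⟨hsi.1.trans_lt hs'.1, hs'.2⟩

/-- Unit speed is given only inside the arcs. At a breakpoint where the curve happens to be smooth
it follows from continuity of the derivative from the right. -/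
theorem norm_deriv_bdry {α : Fin q} {s : ℝ} (hs : s ∈ Set.Ico 0 (T.len α))
    (h : ContDiffAt ℝ 1 (T.bdry α) s) : ‖deriv (T.bdry α) s‖ = 1 := by
  obtain ⟨F, hF⟩ := T.exists_finset_corners α
  have hc : ContinuousAt (deriv (T.bdry α)) s := by
    have := (h.fderiv_right (m := 0) (by norm_num)).continuousAt
    exact (this.clm_apply continuousAt_const : ContinuousAt (fun x => fderiv ℝ (T.bdry α) x 1) s)
  have h1 : Tendsto (fun x => ‖deriv (T.bdry α) x‖) (𝓝[>] s) (𝓝 ‖deriv (T.bdry α) s‖) :=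
    hc.norm.mono_left nhdsWithin_le_nhds
  exact tendsto_nhds_unique h1 (tendsto_const_nhds.congr' ((hF s hs).2.mono fun _ h => h.symm))

theorem bdry_notMem_domain (α : Fin q) (s : ℝ) : T.bdry α s ∉ T.domain := fun hm => by
  have h1 : T.bdry α s ∈ frontier T.domain := by
    rw [T.frontier_domain]; exact Set.mem_iUnion.2 ⟨_, _, rfl⟩
  rw [T.isOpen_domain.frontier_eq] at h1
  exact h1.2 hm

theorem bdry_ne {α : Fin q} {s s' : ℝ} (h : s < s') (h' : s' < s + T.len α) :
    T.bdry α s' ≠ T.bdry α s := fun he => by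
  have hL := T.len_pos α
  have hm : ∀ x, T.bdry α (toIcoMod hL 0 x) = T.bdry α x := fun x => by
    rw [toIcoMod, (T.periodic_bdry α).sub_zsmul_eq]
  have hi : ∀ x, toIcoMod hL 0 x ∈ Set.Ico 0 (T.len α) := fun x => by
    simpa using toIcoMod_mem_Ico hL 0 x
  have := T.injOn_bdry α (hi s) (hi s') (by rw [hm, hm, he])
  obtain ⟨n, hn⟩ := (toIcoMod_eq_toIcoMod hL).1 this
  rw [zsmul_eq_mul] at hn
  have h1 : (0 : ℝ) < n := by
    by_contra hc
    nlinarith [not_lt.1 hc]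
  have h2 : (n : ℝ) < 1 := by
    by_contra hc
    nlinarith [not_lt.1 hc]
  have h1' : 0 < n := by exact_mod_cast h1
  have h2' : n < 1 := by exact_mod_cast h2
  omega

theorem bdry_injective {α β : Fin q} {s s' : ℝ} (hs : s ∈ Set.Ico 0 (T.len α))
    (hs' : s' ∈ Set.Ico 0 (T.len β)) (h : T.bdry α s = T.bdry β s') : (α, s) = (β, s') := by
  obtain rfl : α = β := by
    by_contra hne
    exact Set.disjoint_left.1 (T.disjoint_bdry hne) ⟨s, rfl⟩ ⟨s', h.symm⟩
  rw [T.injOn_bdry α hs hs' h]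

/-- Boundary points near `bdry α s` have a parameter near `s`. -/
theorem eventually_mem_frontier_imp (α : Fin q) (s : ℝ) {δ : ℝ} (hδ : 0 < δ) :
    ∀ᶠ x in 𝓝 (T.bdry α s), x ∈ frontier T.domain → ∃ s', |s' - s| < δ ∧ T.bdry α s' = x := by
  -- Z collects the other components and the part of component α whose parameters stay at least δ
  -- away from s modulo the period. It is a finite union of compact sets that misses the given
  -- point.
  set Z : Set ℂ := ⋃ β : Fin q, T.bdry β ''
    (Set.Icc (if β = α then s + δ else s) (if β = α then s + T.len β - δ else s + T.len β)) with hZ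
  have hZc : IsClosed Z := isClosed_iUnion_of_finite fun β =>
    (isCompact_Icc.image (T.continuous_bdry β)).isClosed
  have hsZ : T.bdry α s ∉ Z := by
    rintro h
    obtain ⟨β, s', hs', he⟩ := Set.mem_iUnion.1 h
    split_ifs at hs' with hβ
    · subst hβ
      exact bdry_ne (by linarith [hs'.1]) (by linarith [hs'.2]) he
    · exact Set.disjoint_left.1 (T.disjoint_bdry hβ) ⟨s', rfl⟩ ⟨s, he.symm⟩
  filter_upwards [hZc.isOpen_compl.mem_nhds hsZ] with x hx hxf
  rw [T.frontier_domain] at hxf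
  obtain ⟨β, s₁, rfl⟩ := Set.mem_iUnion.1 hxf
  obtain ⟨s', hs', he⟩ := (T.periodic_bdry β).exists_mem_Ico (T.len_pos β) s₁ s
  rw [he] at hx ⊢
  by_cases hβ : β = α
  · subst hβ
    by_cases h1 : s' < s + δ
    · exact ⟨s', by rw [abs_lt]; constructor <;> linarith [hs'.1], rfl⟩
    · by_cases h2 : s' ≤ s + T.len β - δ
      · exact (hx (Set.mem_iUnion.2
          ⟨β, s', by rw [if_pos rfl, if_pos rfl]; exact ⟨not_lt.1 h1, h2⟩, rfl⟩)).elim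
      · refine ⟨s' - T.len β, ?_, (T.periodic_bdry β).sub_eq s'⟩
        rw [abs_lt]; constructor <;> linarith [hs'.2, not_le.1 h2]
  · exact (hx (Set.mem_iUnion.2
      ⟨β, s', by rw [if_neg hβ, if_neg hβ]; exact ⟨hs'.1, hs'.2.le⟩, rfl⟩)).elim

/-- Near a smooth boundary point, the directions of a compact transversal set avoid the boundary. -/
theorem eventually_notMem_frontier {α : Fin q} {s : ℝ} {τ : ℂ} (hd : HasDerivAt (T.bdry α) τ s)
    (hτ : τ ≠ 0) {K : Set ℂ} (hK : IsCompact K) (hK0 : ∀ u ∈ K, u.im ≠ 0) :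
    ∀ᶠ r : ℝ in 𝓝[>] 0, ∀ u ∈ K, T.bdry α s + r * (τ * u) ∉ frontier T.domain := by
  rcases K.eq_empty_or_nonempty with rfl | hne
  · simp
  obtain ⟨u₀, hu₀, hmin⟩ := hK.exists_isMinOn hne (continuous_abs.comp Complex.continuous_im).continuousOn
  set c := |u₀.im| with hc
  have hcpos : 0 < c := abs_pos.2 (hK0 u₀ hu₀)
  have hmin' : ∀ u ∈ K, c ≤ |u.im| := fun u hu => hmin hu
  obtain ⟨C, hCpos, hC⟩ := hK.isBounded.exists_pos_norm_le
  -- A boundary point in direction u at scale r, with parameter s', would satisfy |r u - (s' - s)| ≤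
  -- ε |s' - s|. Imaginary parts give r c ≤ ε |s' - s|, and ε ≤ 1/2 gives |s' - s| ≤ 2 r C. Together
  -- r c ≤ 2 ε r C ≤ r c / 2, a contradiction.
  set ε := min (1 / 2) (c / (4 * C)) with hε
  have hεpos : 0 < ε := by positivity
  have hε1 : ε ≤ 1 / 2 := min_le_left _ _
  have hε2 : ε * (4 * C) ≤ c := by
    rw [← le_div_iff₀ (by positivity)]; exact min_le_right _ _
  have hτ' : 0 < ‖τ‖ := norm_pos_iff.2 hτ
  have hlo := (hasDerivAt_iff_isLittleO.1 hd).def (mul_pos hεpos hτ')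
  obtain ⟨δ, hδ, hlo⟩ := Metric.eventually_nhds_iff.1 hlo
  obtain ⟨ρ, hρ, hfr⟩ := Metric.eventually_nhds_iff.1 (T.eventually_mem_frontier_imp α s hδ)
  have hsmall : ∀ᶠ r : ℝ in 𝓝[>] 0, r < ρ / (‖τ‖ * C) :=
    (gt_mem_nhds (by positivity)).filter_mono nhdsWithin_le_nhds
  filter_upwards [hsmall, self_mem_nhdsWithin] with r hr (hr0 : 0 < r) u hu hmem
  rw [lt_div_iff₀ (by positivity)] at hr
  obtain ⟨s', hs', he⟩ := hfr (y := T.bdry α s + r * (τ * u)) (by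
    rw [dist_eq_norm, add_sub_cancel_left, norm_mul, norm_mul, Complex.norm_real,
      Real.norm_of_nonneg hr0.le]
    have : ‖τ‖ * ‖u‖ ≤ ‖τ‖ * C := mul_le_mul_of_nonneg_left (hC u hu) hτ'.le
    nlinarith) hmem
  have h1 := hlo (y := s') (by rwa [Real.dist_eq])
  rw [he, add_sub_cancel_left, Complex.real_smul,
    show (r : ℂ) * (τ * u) - ((s' - s : ℝ) : ℂ) * τ = τ * (r * u - ((s' - s : ℝ) : ℂ)) by ring,
    norm_mul, Real.norm_eq_abs] at h1
  have h2 : ‖(r : ℂ) * u - ((s' - s : ℝ) : ℂ)‖ ≤ ε * |s' - s| := by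
    have : ‖τ‖ * ‖(r : ℂ) * u - ((s' - s : ℝ) : ℂ)‖ ≤ ‖τ‖ * (ε * |s' - s|) := by linarith
    exact le_of_mul_le_mul_left this hτ'
  have h3 : r * c ≤ ε * |s' - s| := by
    refine le_trans ?_ ((Complex.abs_im_le_norm _).trans h2)
    rw [Complex.sub_im, Complex.ofReal_im, sub_zero, Complex.im_ofReal_mul,
      abs_mul, abs_of_pos hr0]
    exact mul_le_mul_of_nonneg_left (hmin' u hu) hr0.le
  have h4 : |s' - s| ≤ r * C + ε * |s' - s| := by
    have h5 := norm_sub_norm_le (((s' - s : ℝ) : ℂ)) (r * u)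
    rw [norm_sub_rev, Complex.norm_real, norm_mul, Complex.norm_real, Real.norm_of_nonneg hr0.le,
      Real.norm_eq_abs] at h5
    have := mul_le_mul_of_nonneg_left (hC u hu) hr0.le
    linarith
  have h6 : |s' - s| ≤ 2 * (r * C) := by nlinarith [abs_nonneg (s' - s)]
  have h7 : ε * |s' - s| ≤ ε * (2 * (r * C)) := mul_le_mul_of_nonneg_left h6 hεpos.le
  nlinarith

theorem im_pos_of_mem_segment {u v x : ℂ} (hu : 0 < u.im) (hv : 0 < v.im) (hx : x ∈ segment ℝ u v) :
    0 < x.im :=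
  (convex_halfSpace_im_gt 0).segment_subset hu hv hx

/-- With zero derivative, the orientation condition would put one point both in the domain and
outside it. -/
theorem deriv_bdry_ne_zero {α : Fin q} {s : ℝ} (h : ContDiffAt ℝ 1 (T.bdry α) s) :
    deriv (T.bdry α) s ≠ 0 := fun h0 => by
  have := T.oriented_bdry α s h
  simp only [h0, mul_zero, add_zero, sub_zero] at this
  obtain ⟨ε, h1, h2⟩ := this.exists
  exact h2 h1

theorem exists_mem_frontier_of_segment {a : ℂ} {b u v : ℂ} (hu : a + b * u ∈ T.domain)
    (hv : a + b * v ∉ T.domain) : ∃ x ∈ segment ℝ u v, a + b * x ∈ frontier T.domain := by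
  have hpre : IsPreconnected ((fun x => a + b * x) '' segment ℝ u v) :=
    (convex_segment u v).isPreconnected.image _ (by fun_prop)
  by_contra! hc
  have hext : ∀ x ∈ segment ℝ u v, a + b * x ∉ T.domain → a + b * x ∈ (closure T.domain)ᶜ :=
    fun x hx hxd hcl => hc x hx (by rw [T.isOpen_domain.frontier_eq]; exact ⟨hcl, hxd⟩)
  obtain ⟨y, -, hy, hy'⟩ := hpre T.domain (closure T.domain)ᶜ T.isOpen_domain
    isClosed_closure.isOpen_compl
    (by rintro _ ⟨x, hx, rfl⟩; exact (em _).imp id (hext x hx))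
    ⟨_, ⟨u, left_mem_segment ℝ u v, rfl⟩, hu⟩
    ⟨_, ⟨v, right_mem_segment ℝ u v, rfl⟩, hext v (right_mem_segment ℝ u v) hv⟩
  exact hy' (subset_closure hy)

/-- Orientation settles the normal direction `Complex.I`. The segment from it to u is a compact set
of transversal directions, so at small scales it meets no boundary, and connectedness carries
membership over to u. -/
theorem eventually_mem_domain {α : Fin q} {s : ℝ} (h : ContDiffAt ℝ 1 (T.bdry α) s) {u : ℂ}
    (hu : 0 < u.im) :
    ∀ᶠ r : ℝ in 𝓝[>] 0, T.bdry α s + r * (deriv (T.bdry α) s * u) ∈ T.domain := by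
  have hK : IsCompact (segment ℝ Complex.I u) := by
    rw [segment_eq_image_lineMap]; exact isCompact_Icc.image (by fun_prop)
  have h1 := eventually_notMem_frontier (h.differentiableAt one_ne_zero).hasDerivAt
    (deriv_bdry_ne_zero h) hK fun x hx => (im_pos_of_mem_segment (by simp) hu hx).ne'
  filter_upwards [h1, T.oriented_bdry α s h] with r hr hor
  by_contra hc
  obtain ⟨x, hx, hxf⟩ := exists_mem_frontier_of_segment (T := T) (a := T.bdry α s)
    (b := r * deriv (T.bdry α) s) (u := Complex.I) (v := u)
    (by convert hor.1 using 2; ring) (by rwa [mul_assoc])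
  exact hr x hx (by rwa [mul_assoc] at hxf)

theorem eventually_notMem_domain {α : Fin q} {s : ℝ} (h : ContDiffAt ℝ 1 (T.bdry α) s) {u : ℂ}
    (hu : u.im < 0) :
    ∀ᶠ r : ℝ in 𝓝[>] 0, T.bdry α s + r * (deriv (T.bdry α) s * u) ∉ T.domain := by
  have hK : IsCompact (segment ℝ u (-Complex.I)) := by
    rw [segment_eq_image_lineMap]; exact isCompact_Icc.image (by fun_prop)
  have h1 := eventually_notMem_frontier (h.differentiableAt one_ne_zero).hasDerivAt
    (deriv_bdry_ne_zero h) hK fun x hx =>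
      ((convex_halfSpace_im_lt 0).segment_subset hu (by simp) hx : x.im < 0).ne
  filter_upwards [h1, T.oriented_bdry α s h] with r hr hor hc
  obtain ⟨x, hx, hxf⟩ := exists_mem_frontier_of_segment (T := T) (a := T.bdry α s)
    (b := r * deriv (T.bdry α) s) (u := u) (v := -Complex.I)
    (by rwa [mul_assoc]) (by convert hor.2 using 2; ring)
  exact hr x hx (by rwa [mul_assoc] at hxf)

/-- The ray from `z` first leaves the domain at the boundary point with parameters `x`. -/
def Hits (z : T.Phase) (x : Fin q × ℝ) : Prop :=
  z.Regular ∧ x.2 ∈ Set.Ico 0 (T.len x.1) ∧ ∃ t : ℝ, 0 < t ∧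
    T.bdry x.1 x.2 = z.foot + t * z.dir ∧ ∀ r ∈ Set.Ioo 0 t, z.foot + (r : ℂ) * z.dir ∈ T.domain

theorem Phase.Regular.norm_dir {z : T.Phase} (h : z.Regular) : ‖z.dir‖ = 1 := by
  rw [Phase.dir, norm_mul, Complex.norm_exp_ofReal_mul_I, mul_one]
  exact norm_deriv_bdry z.2.1 h.1

/-- The hit is at the infimum of the times spent outside the domain: positive because the ray starts
inward, finite because the domain is bounded. -/
theorem Phase.Regular.exists_hits {z : T.Phase} (h : z.Regular) : ∃ x, Hits z x := by
  have hev : ∀ᶠ r : ℝ in 𝓝[>] 0, z.foot + r * z.dir ∈ T.domain := by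
    refine eventually_mem_domain h.1 (u := Complex.exp (z.angle * Complex.I)) ?_
    rw [Complex.exp_ofReal_mul_I_im]
    exact Real.sin_pos_of_mem_Ioo h.2
  obtain ⟨ε, hε0, hε⟩ := (mem_nhdsGT_iff_exists_Ioo_subset).1 hev
  set S : Set ℝ := {r | 0 < r ∧ z.foot + r * z.dir ∉ T.domain} with hS
  have hcont : Continuous fun r : ℝ => z.foot + (r : ℂ) * z.dir := by fun_prop
  have hSne : S.Nonempty := by
    obtain ⟨R, hRpos, hR⟩ := T.isBounded_domain.exists_pos_norm_le
    refine ⟨R + ‖z.foot‖ + 1, by positivity, fun hmem => ?_⟩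
    have h1 := hR _ hmem
    have h2 := norm_sub_norm_le (((R + ‖z.foot‖ + 1 : ℝ) : ℂ) * z.dir) (-z.foot)
    rw [norm_mul, h.norm_dir, mul_one, Complex.norm_real, Real.norm_of_nonneg (by positivity),
      norm_neg, sub_neg_eq_add, add_comm (_ * _)] at h2
    linarith
  have hlb : ∀ r ∈ S, ε ≤ r := fun r hr => by
    by_contra hc
    exact hr.2 (hε ⟨hr.1, not_le.1 hc⟩)
  set t := sInf S with ht
  have htpos : 0 < t := lt_of_lt_of_le hε0 (le_csInf hSne hlb)
  have hbelow : ∀ r ∈ Set.Ioo 0 t, z.foot + (r : ℂ) * z.dir ∈ T.domain := fun r hr => by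
    by_contra hc
    exact absurd (csInf_le ⟨ε, hlb⟩ (⟨hr.1, hc⟩ : r ∈ S)) (not_le.2 hr.2)
  have hnot : z.foot + (t : ℂ) * z.dir ∉ T.domain := fun hmem => by
    have hnhds : ∀ᶠ r in 𝓝 t, z.foot + ((r : ℝ) : ℂ) * z.dir ∈ T.domain :=
      hcont.continuousAt.eventually (T.isOpen_domain.mem_nhds hmem)
    obtain ⟨η, hη, hηs⟩ := Metric.eventually_nhds_iff.1 hnhds
    obtain ⟨r, hrS, hr⟩ := exists_lt_of_csInf_lt hSne (show sInf S < t + η by linarith)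
    have := csInf_le ⟨ε, hlb⟩ hrS
    exact hrS.2 (hηs (by rw [Real.dist_eq, abs_lt]; constructor <;> linarith))
  have hfr : z.foot + (t : ℂ) * z.dir ∈ frontier T.domain := by
    rw [T.isOpen_domain.frontier_eq]
    refine ⟨?_, hnot⟩
    refine mem_closure_of_tendsto (b := 𝓝[<] t) (f := fun r : ℝ => z.foot + (r : ℂ) * z.dir)
      (hcont.continuousAt.mono_left nhdsWithin_le_nhds) ?_
    filter_upwards [Ioo_mem_nhdsLT htpos] with r hr using hbelow r hr
  rw [T.frontier_domain] at hfr
  obtain ⟨β, s₁, hs₁⟩ := Set.mem_iUnion.1 hfr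
  obtain ⟨s', hs', he⟩ := (T.periodic_bdry β).exists_mem_Ico (T.len_pos β) s₁ 0
  rw [zero_add] at hs'
  exact ⟨(β, s'), h, hs', t, htpos, by rw [← hs₁, he], hbelow⟩

theorem Hits.unique {z : T.Phase} {x x' : Fin q × ℝ} (h : Hits z x) (h' : Hits z x') : x = x' := by
  obtain ⟨-, hx, t, ht, hf, hd⟩ := h
  obtain ⟨-, hx', t', ht', hf', hd'⟩ := h'
  refine bdry_injective hx hx' ?_
  rcases lt_trichotomy t t' with h | h | h
  · exact absurd (hf ▸ hd' t ⟨ht, h⟩) (bdry_notMem_domain _ _)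
  · rw [hf, hf', h]
  · exact absurd (hf' ▸ hd t' ⟨ht', h⟩) (bdry_notMem_domain _ _)

theorem Collides.hits {z w : T.Phase} (h : Collides z w) : Hits z (w.comp, w.coord) :=
  ⟨h.1, w.2.1, h.2.2.1⟩

theorem Hits.exists_collides {z : T.Phase} {x : Fin q × ℝ} (h : Hits z x)
    (hx : ContDiffAt ℝ 1 (T.bdry x.1) x.2) (hne : (z.dir / deriv (T.bdry x.1) x.2).im ≠ 0) :
    ∃ w, Collides z w := by
  obtain ⟨hz, hx2, t, ht, hf, hd⟩ := h
  set τ := deriv (T.bdry x.1) x.2 with hτ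
  have hτ0 : τ ≠ 0 := deriv_bdry_ne_zero hx
  set u := z.dir / τ with hu
  have hdu : z.dir = τ * u := by rw [hu]; field_simp
  -- The ray arrives from inside. If u pointed inward, the points just before impact, in direction
  -- -u, would lie outside the domain.
  have hneg : u.im < 0 := by
    by_contra hc
    have hpos : 0 < u.im := lt_of_le_of_ne (not_lt.1 hc) hne.symm
    have hev := eventually_notMem_domain hx (u := -u) (by simpa using hpos)
    obtain ⟨r, hr, hrt⟩ := (hev.and (Ioo_mem_nhdsGT ht)).exists
    refine hr ?_
    convert hd (t - r) ⟨by linarith [hrt.2], by linarith [hrt.1]⟩ using 1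
    rw [hf, hdu]
    push_cast
    ring
  have hun : ‖u‖ = 1 := by
    rw [hu, norm_div, hz.norm_dir, hτ, norm_deriv_bdry hx2 hx, div_one]
  have harg : -Complex.arg u ∈ Set.Ioo 0 Real.pi := by
    constructor
    · have := Complex.arg_neg_iff.2 hneg
      linarith
    · linarith [Complex.neg_pi_lt_arg u]
  -- The reflection law asks for u = exp(-iθ), so θ is minus the argument of u.
  refine ⟨⟨(x.1, x.2, -Complex.arg u), hx2, harg.1.le, harg.2.le⟩, hz, ⟨hx, harg⟩,
    ⟨t, ht, hf, hd⟩, ?_⟩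
  change z.dir = τ * Complex.exp (-(((-Complex.arg u : ℝ) : ℂ) * Complex.I))
  rw [hdu]
  congr 1
  have := Complex.norm_mul_exp_arg_mul_I u
  rw [hun] at this
  simpa using this.symm

/-- Reversal of the direction of motion. -/
noncomputable def Phase.rev (z : T.Phase) : T.Phase :=
  ⟨(z.1.1, z.1.2.1, Real.pi - z.1.2.2), z.2.1, by linarith [z.2.2.2], by linarith [z.2.2.1]⟩

@[simp] theorem Phase.rev_rev (z : T.Phase) : z.rev.rev = z := by
  apply Subtype.ext
  simp [Phase.rev]

theorem Phase.rev_injective : Function.Injective (Phase.rev (T := T)) :=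
  Function.LeftInverse.injective Phase.rev_rev

theorem Phase.dir_rev (z : T.Phase) :
    z.rev.dir = -(z.tangent * Complex.exp (-(z.angle * Complex.I))) := by
  change z.tangent * Complex.exp (((Real.pi - z.angle : ℝ) : ℂ) * Complex.I) = _
  rw [Complex.ofReal_sub, sub_mul, sub_eq_add_neg, Complex.exp_add, Complex.exp_pi_mul_I]
  ring

theorem Phase.dir_eq_rev (z : T.Phase) :
    z.dir = -(z.rev.tangent * Complex.exp (-(z.rev.angle * Complex.I))) := by
  rw [← Phase.dir_rev, Phase.rev_rev]

theorem Phase.Regular.rev {z : T.Phase} (h : z.Regular) : z.rev.Regular :=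
  ⟨h.1, by have := h.2.2; change 0 < Real.pi - z.angle; linarith,
    by have := h.2.1; change Real.pi - z.angle < Real.pi; linarith⟩

theorem Collides.dir_rev {z w : T.Phase} (h : Collides z w) : w.rev.dir = -z.dir := by
  rw [Phase.dir_rev, h.2.2.2]

/-- The reversed ray retraces the same chord. Together with single-valuedness this makes the
billiard map injective where it is defined. -/
theorem Collides.rev {z w : T.Phase} (h : Collides z w) : Collides w.rev z.rev := by
  have hdir := h.dir_rev
  obtain ⟨hz, hw, ⟨t, ht, hf, hd⟩, -⟩ := h
  have hf : w.rev.foot = z.foot + t * z.dir := hf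
  have hf' : z.rev.foot = z.foot := rfl
  refine ⟨hw.rev, hz.rev, ⟨t, ht, ?_, fun r hr => ?_⟩, ?_⟩
  · rw [hdir, hf, hf']; ring
  · rw [hdir, hf]
    convert hd (t - r) ⟨by linarith [hr.2], by linarith [hr.1]⟩ using 1
    push_cast
    ring
  · rw [hdir, Phase.dir_eq_rev, neg_neg]

theorem Collides.injective {z z' w : T.Phase} (h : Collides z w) (h' : Collides z' w) : z = z' :=
  Phase.rev_injective (h.rev.unique h'.rev)

end BilliardTable

/-! ### Measurability of the collision relation and the billiard map -/

namespace BilliardTable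

variable {q : ℕ} {T : BilliardTable q}

variable (T) in
theorem measurableSet_phaseSet : MeasurableSet T.phaseSet := by
  have h1 : Measurable fun z : Fin q × ℝ × ℝ => z.2.1 := measurable_fst.comp measurable_snd
  have h2 : Measurable fun z : Fin q × ℝ × ℝ => z.2.2 := measurable_snd.comp measurable_snd
  have h3 : Measurable fun z : Fin q × ℝ × ℝ => T.len z.1 :=
    (measurable_of_countable T.len).comp measurable_fst
  exact ((measurableSet_le measurable_const h1).inter (measurableSet_lt h1 h3)).inter
    (h2 measurableSet_Icc)

instance : StandardBorelSpace T.Phase := T.measurableSet_phaseSet.standardBorel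

variable (T) in
theorem measurable_bdry : Measurable fun x : Fin q × ℝ => T.bdry x.1 x.2 :=
  measurable_from_prod_countable_right fun α => (T.continuous_bdry α).measurable

variable (T) in
theorem measurable_deriv_bdry : Measurable fun x : Fin q × ℝ => deriv (T.bdry x.1) x.2 :=
  measurable_from_prod_countable_right fun α => measurable_deriv (T.bdry α)

variable (T) in
theorem measurableSet_smooth : MeasurableSet {x : Fin q × ℝ | ContDiffAt ℝ 1 (T.bdry x.1) x.2} := by
  refine measurableSet_setOfPred.2 (measurable_from_prod_countable_right fun α => measurableSet_setOfPred.1 ?_)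
  refine IsOpen.measurableSet (isOpen_iff_mem_nhds.2 fun s hs => ?_)
  exact ContDiffAt.eventually (n := 1) (f := T.bdry α) hs (by simp)

theorem measurable_compCoord : Measurable fun z : T.Phase => (z.comp, z.coord) :=
  measurable_comp.prodMk measurable_coord

theorem measurable_foot : Measurable (Phase.foot (T := T)) :=
  T.measurable_bdry.comp measurable_compCoord

theorem measurable_tangent : Measurable (Phase.tangent (T := T)) :=
  T.measurable_deriv_bdry.comp measurable_compCoord

theorem measurable_dir : Measurable (Phase.dir (T := T)) :=
  measurable_tangent.mul (Complex.measurable_exp.comp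
    ((Complex.measurable_ofReal.comp measurable_angle).mul_const _))

theorem measurableSet_regular : MeasurableSet {z : T.Phase | z.Regular} :=
  (measurable_compCoord T.measurableSet_smooth).inter (measurable_angle measurableSet_Ioo)

/-- The open segment is exhausted by countably many compact ones, and containing a compact segment
in an open set is an open condition. -/
theorem measurableSet_openSegment_subset {U : Set ℂ} (hU : IsOpen U) :
    MeasurableSet {p : ℂ × ℂ | ∀ r ∈ Set.Ioo (0 : ℝ) 1, p.1 + r * p.2 ∈ U} := by
  have : {p : ℂ × ℂ | ∀ r ∈ Set.Ioo (0 : ℝ) 1, p.1 + r * p.2 ∈ U} =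
      ⋂ n : ℕ, {p : ℂ × ℂ | ∀ r ∈ Set.Icc (1 / (n + 1 : ℝ)) (1 - 1 / (n + 1 : ℝ)),
        p.1 + r * p.2 ∈ U} := by
    ext p
    simp only [Set.mem_iInter]
    refine ⟨fun h n r hr => h r ?_, fun h r hr => ?_⟩
    · have : (0 : ℝ) < 1 / (n + 1 : ℝ) := by positivity
      exact ⟨by linarith [hr.1], by linarith [hr.2]⟩
    · obtain ⟨n, hn⟩ := exists_nat_one_div_lt (lt_min hr.1 (sub_pos.2 hr.2))
      exact h n r ⟨(hn.trans_le (min_le_left _ _)).le, by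
        have := hn.trans_le (min_le_right _ _); linarith⟩
  rw [this]
  refine .iInter fun n => IsOpen.measurableSet (isOpen_iff_mem_nhds.2 fun p hp => ?_)
  refine isCompact_Icc.eventually_forall_of_forall_eventually fun r hr => ?_
  have hc : Continuous fun x : (ℂ × ℂ) × ℝ => x.1.1 + (x.2 : ℂ) * x.1.2 := by fun_prop
  exact hc.continuousAt.eventually (hU.mem_nhds (hp r hr))

/-- The direction has norm one, so the travel time must be the distance. This removes the
existential over t and leaves conditions visibly Borel in (z, x). -/
theorem hits_iff {z : T.Phase} {x : Fin q × ℝ} : Hits z x ↔ z.Regular ∧ x.2 ∈ Set.Ico 0 (T.len x.1) ∧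
    T.bdry x.1 x.2 - z.foot ≠ 0 ∧
    T.bdry x.1 x.2 - z.foot = (‖T.bdry x.1 x.2 - z.foot‖ : ℝ) * z.dir ∧
    ∀ r ∈ Set.Ioo (0 : ℝ) 1, z.foot + r * (T.bdry x.1 x.2 - z.foot) ∈ T.domain := by
  refine and_congr_right fun hz => and_congr_right fun hx => ⟨?_, ?_⟩
  · rintro ⟨t, ht, hf, hd⟩
    have h1 : T.bdry x.1 x.2 - z.foot = t * z.dir := by rw [hf]; ring
    have h2 : ‖T.bdry x.1 x.2 - z.foot‖ = t := by
      rw [h1, norm_mul, hz.norm_dir, mul_one, Complex.norm_real, Real.norm_of_nonneg ht.le]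
    refine ⟨fun h0 => ?_, by rw [h2, h1], fun r hr => ?_⟩
    · rw [h0, norm_zero] at h2
      exact ht.ne h2
    · rw [h1]
      convert hd (r * t) ⟨mul_pos hr.1 ht, by nlinarith [hr.2]⟩ using 2
      push_cast; ring
  · rintro ⟨h0, h1, h2⟩
    have ht := norm_pos_iff.2 h0
    refine ⟨_, ht, by rw [← h1]; ring, fun r hr => ?_⟩
    convert h2 (r / ‖T.bdry x.1 x.2 - z.foot‖) ⟨div_pos hr.1 ht, (div_lt_one ht).2 hr.2⟩ using 2
    have ht' : ((‖T.bdry x.1 x.2 - z.foot‖ : ℝ) : ℂ) ≠ 0 := by exact_mod_cast ht.ne'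
    refine Eq.trans ?_ (congrArg _ h1).symm
    rw [Complex.ofReal_div, ← mul_assoc, div_mul_cancel₀ _ ht']

theorem measurableSet_hits : MeasurableSet {p : T.Phase × (Fin q × ℝ) | Hits p.1 p.2} := by
  have hb : Measurable fun p : T.Phase × (Fin q × ℝ) => T.bdry p.2.1 p.2.2 :=
    T.measurable_bdry.comp measurable_snd
  have hf : Measurable fun p : T.Phase × (Fin q × ℝ) => p.1.foot := measurable_foot.comp measurable_fst
  have hd : Measurable fun p : T.Phase × (Fin q × ℝ) => p.1.dir := measurable_dir.comp measurable_fst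
  have hs : Measurable fun p : T.Phase × (Fin q × ℝ) => p.2.2 := measurable_snd.comp measurable_snd
  have hl : Measurable fun p : T.Phase × (Fin q × ℝ) => T.len p.2.1 :=
    (measurable_of_countable T.len).comp (measurable_fst.comp measurable_snd)
  simp only [hits_iff]
  refine (measurable_fst measurableSet_regular).inter (.inter
    ((measurableSet_le measurable_const hs).inter (measurableSet_lt hs hl)) (.inter ?_ (.inter ?_ ?_)))
  · exact ((hb.sub hf) (measurableSet_singleton 0)).compl
  · exact measurableSet_eq_fun (hb.sub hf) ((Complex.measurable_ofReal.comp (hb.sub hf).norm).mul hd)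
  · exact (hf.prodMk (hb.sub hf)) (measurableSet_openSegment_subset T.isOpen_domain)

/-- Projections along the first hit are measurable. -/
theorem measurableSet_exists_hits {P : T.Phase × (Fin q × ℝ) → Prop} (hP : MeasurableSet {p | P p}) :
    MeasurableSet {z : T.Phase | ∃ x, Hits z x ∧ P (z, x)} := by
  -- First hits are unique, so the projection is injective on this Borel set and its image is Borel
  -- by Lusin–Souslin.
  have h := (measurableSet_hits.inter hP).image_of_measurable_injOn measurable_fst
    (fun p hp p' hp' (h : p.1 = p'.1) =>
      Prod.ext h (Hits.unique (h ▸ hp.1 : Hits p'.1 p.2) hp'.1))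
  convert h using 1
  ext z
  constructor
  · rintro ⟨x, h⟩
    exact ⟨(z, x), h, rfl⟩
  · rintro ⟨⟨z', x⟩, h, rfl⟩
    exact ⟨x, h⟩

theorem collides_iff {z w : T.Phase} : Collides z w ↔ Hits z (w.comp, w.coord) ∧ w.Regular ∧
    z.dir = w.tangent * Complex.exp (-(w.angle * Complex.I)) :=
  ⟨fun h => ⟨h.hits, h.2.1, h.2.2.2⟩, fun h => ⟨h.1.1, h.2.1, h.1.2.2, h.2.2⟩⟩

theorem measurableSet_collides : MeasurableSet {p : T.Phase × T.Phase | Collides p.1 p.2} := by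
  simp only [collides_iff]
  refine .inter ((measurable_fst.prodMk (measurable_compCoord.comp measurable_snd)) measurableSet_hits)
    (.inter (measurable_snd measurableSet_regular) (measurableSet_eq_fun
      (measurable_dir.comp measurable_fst) ?_))
  refine (measurable_tangent.comp measurable_snd).mul (Complex.measurable_exp.comp ?_)
  exact ((Complex.measurable_ofReal.comp (measurable_angle.comp measurable_snd)).mul_const _).neg

theorem measurableSet_exists_collides {B : Set T.Phase} (hB : MeasurableSet B) :
    MeasurableSet {z : T.Phase | ∃ w, Collides z w ∧ w ∈ B} := by
  have h := (measurableSet_collides.inter (measurable_snd hB)).image_of_measurable_injOn measurable_fst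
    (fun p hp p' hp' (h : p.1 = p'.1) =>
      Prod.ext h (Collides.unique (h ▸ hp.1 : Collides p'.1 p.2) hp'.1))
  convert h using 1
  ext z
  constructor
  · rintro ⟨x, h⟩
    exact ⟨(z, x), h, rfl⟩
  · rintro ⟨⟨z', x⟩, h, rfl⟩
    exact ⟨x, h⟩

theorem measurableSet_collisionDomain : MeasurableSet {z : T.Phase | ∃ w, Collides z w} := by
  simpa using measurableSet_exists_collides (T := T) .univ

theorem measurable_billiardMap : Measurable (billiardMap (T := T)) := fun B hB => by
  have : billiardMap ⁻¹' B = {z : T.Phase | ∃ w, Collides z w ∧ w ∈ B} ∪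
      ({z : T.Phase | ∃ w, Collides z w}ᶜ ∩ B) := by
    ext z
    by_cases h : ∃ w, Collides z w
    · obtain ⟨w, hw⟩ := h
      have hD : ∃ w, Collides z w := ⟨w, hw⟩
      simp only [Set.mem_preimage, billiardMap_of_collides hw, Set.mem_union, Set.mem_ofPred_eq,
        Set.mem_inter_iff, Set.mem_compl_iff, hD, not_true, false_and, or_false]
      exact ⟨fun h => ⟨w, hw, h⟩, fun ⟨w', hw', h⟩ => hw.unique hw' ▸ h⟩
    · have h' : ¬ ∃ w, Collides z w ∧ w ∈ B := fun ⟨w, hw, _⟩ => h ⟨w, hw⟩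
      simp only [Set.mem_preimage, billiardMap_of_not_collides h, Set.mem_union, Set.mem_ofPred_eq,
        Set.mem_inter_iff, Set.mem_compl_iff, h, h', not_false_eq_true, true_and, false_or]
  rw [this]
  exact (measurableSet_exists_collides hB).union (measurableSet_collisionDomain.compl.inter hB)

theorem injOn_billiardMap : Set.InjOn (billiardMap (T := T)) {z | ∃ w, Collides z w} := by
  rintro z ⟨w, hw⟩ z' ⟨w', hw'⟩ h
  rw [billiardMap_of_collides hw, billiardMap_of_collides hw'] at h
  exact hw.injective (h ▸ hw')

theorem measurable_rev : Measurable (Phase.rev (T := T)) :=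
  Measurable.subtype_mk (measurable_comp.prodMk (measurable_coord.prodMk (measurable_angle.const_sub _)))

end BilliardTable

/-! ### The Liouville measure as the measure on oriented lines -/

theorem Function.Periodic.setLIntegral_Ioc_eq {H : ℝ → ENNReal} {P : ℝ} (hH : Function.Periodic H P)
    (hP : 0 < P) (a b : ℝ) : ∫⁻ u in Set.Ioc a (a + P), H u = ∫⁻ u in Set.Ioc b (b + P), H u :=
  (isAddFundamentalDomain_Ioc hP a).setLIntegral_eq (isAddFundamentalDomain_Ioc hP b) H
    hH.map_vadd_zmultiples

namespace BilliardTable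

variable {q : ℕ} {T : BilliardTable q}

theorem liouville_apply {A : Set T.Phase} (hA : MeasurableSet A) :
    T.liouville A = ∑ α, ∫⁻ s, ∫⁻ θ, (Subtype.val '' A : Set (Fin q × ℝ × ℝ)).indicator
      (fun z => ENNReal.ofReal (Real.sin z.2.2)) (α, s, θ) := by
  have hA' : MeasurableSet (Subtype.val '' A : Set (Fin q × ℝ × ℝ)) :=
    T.measurableSet_phaseSet.subtype_image hA
  have hm : Measurable fun z : Fin q × ℝ × ℝ => ENNReal.ofReal (Real.sin z.2.2) := by fun_prop
  have hi := hm.indicator hA'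
  rw [liouville, (MeasurableEmbedding.subtype_coe T.measurableSet_phaseSet).comap_apply,
    withDensity_apply _ hA', ← lintegral_indicator hA', lintegral_prod _ hi.aemeasurable,
    lintegral_count, tsum_fintype]
  refine Finset.sum_congr rfl fun α _ => ?_
  exact lintegral_prod _ (hi.comp measurable_prodMk_left).aemeasurable

theorem liouville_eq_zero_of_sections {A : Set T.Phase} (hA : MeasurableSet A)
    (h : ∀ α, ∀ᵐ s : ℝ, volume {θ : ℝ | (α, s, θ) ∈ (Subtype.val '' A : Set (Fin q × ℝ × ℝ))} = 0) :
    T.liouville A = 0 := by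
  rw [liouville_apply hA]
  refine Finset.sum_eq_zero fun α _ => ?_
  rw [lintegral_congr_ae (g := fun _ => 0) ((h α).mono fun s hs => ?_), lintegral_zero]
  refine (lintegral_congr_ae (g := fun _ => 0) ?_).trans lintegral_zero
  have : ∀ᵐ θ : ℝ, (α, s, θ) ∉ (Subtype.val '' A : Set (Fin q × ℝ × ℝ)) := by
    rw [ae_iff]; simpa only [not_not] using hs
  exact this.mono fun θ hθ => Set.indicator_of_notMem hθ _

variable (T) in
theorem liouville_univ : T.liouville Set.univ = ∑ α, ENNReal.ofReal (T.len α) * 2 := by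
  rw [liouville_apply .univ]
  refine Finset.sum_congr rfl fun α _ => ?_
  have hsin : ∫⁻ θ in Set.Icc 0 Real.pi, ENNReal.ofReal (Real.sin θ) = 2 := by
    rw [← ofReal_integral_eq_lintegral_ofReal
      (Real.continuous_sin.continuousOn.integrableOn_compact isCompact_Icc)
      (ae_restrict_of_forall_mem measurableSet_Icc fun θ hθ => Real.sin_nonneg_of_mem_Icc hθ),
      integral_Icc_eq_integral_Ioc, ← intervalIntegral.integral_of_le Real.pi_pos.le, integral_sin]
    norm_num
  have : ∀ s : ℝ, ∫⁻ θ, (Subtype.val '' (Set.univ : Set T.Phase) : Set (Fin q × ℝ × ℝ)).indicator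
      (fun z => ENNReal.ofReal (Real.sin z.2.2)) (α, s, θ)
      = (Set.Ico 0 (T.len α)).indicator (fun _ => 2) s := fun s => by
    by_cases hs : s ∈ Set.Ico 0 (T.len α)
    · rw [Set.indicator_of_mem hs, ← hsin, ← lintegral_indicator measurableSet_Icc]
      refine lintegral_congr fun θ => ?_
      by_cases hθ : θ ∈ Set.Icc 0 Real.pi
      · rw [Set.indicator_of_mem hθ, Set.indicator_of_mem]
        exact ⟨⟨_, hs, hθ⟩, trivial, rfl⟩
      · rw [Set.indicator_of_notMem hθ, Set.indicator_of_notMem]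
        rintro ⟨⟨z, hz⟩, -, rfl⟩
        exact hθ hz.2
    · rw [Set.indicator_of_notMem hs]
      refine (lintegral_congr fun θ => Set.indicator_of_notMem ?_ _).trans lintegral_zero
      rintro ⟨⟨z, hz⟩, -, rfl⟩
      exact hs hz.1
  rw [lintegral_congr this, lintegral_indicator_const measurableSet_Ico, Real.volume_Ico, sub_zero,
    mul_comm]

instance : IsFiniteMeasure T.liouville :=
  ⟨by rw [liouville_univ]; exact ENNReal.sum_lt_top.2 fun α _ => by finiteness⟩

-- A nonempty bounded domain has nonempty frontier, hence there is at least one boundary component.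
variable (T) in
theorem liouville_univ_ne_zero : T.liouville Set.univ ≠ 0 := by
  have hne : (frontier T.domain).Nonempty := by
    refine nonempty_frontier_iff.2 ⟨T.isConnected_domain.nonempty, fun h => ?_⟩
    exact NormedSpace.unbounded_univ ℝ ℂ (h ▸ T.isBounded_domain)
  rw [T.frontier_domain] at hne
  obtain ⟨x, hx⟩ := hne
  obtain ⟨α, -⟩ := Set.mem_iUnion.1 hx
  rw [liouville_univ]
  refine fun h => ?_
  have := Finset.sum_eq_zero_iff.1 h α (Finset.mem_univ α)
  simp only [mul_eq_zero, ENNReal.ofReal_eq_zero, OfNat.ofNat_ne_zero, or_false] at this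
  exact absurd this (not_le.2 (T.len_pos α))

theorem liouville_preimage_rev {A : Set T.Phase} (hA : MeasurableSet A) :
    T.liouville (Phase.rev ⁻¹' A) = T.liouville A := by
  rw [liouville_apply hA, liouville_apply (measurable_rev hA)]
  refine Finset.sum_congr rfl fun α _ => lintegral_congr fun s => ?_
  rw [← lintegral_sub_left_eq_self _ Real.pi]
  refine lintegral_congr fun θ => ?_
  have hiff : (α, s, Real.pi - θ) ∈ (Subtype.val '' (Phase.rev ⁻¹' A) : Set (Fin q × ℝ × ℝ)) ↔
      (α, s, θ) ∈ (Subtype.val '' A : Set (Fin q × ℝ × ℝ)) := by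
    constructor
    · rintro ⟨z, hz, he⟩
      exact ⟨Phase.rev z, hz, by simp [Phase.rev, he]⟩
    · rintro ⟨z, hz, he⟩
      exact ⟨Phase.rev z, by simpa using hz, by simp [Phase.rev, he]⟩
  by_cases h : (α, s, θ) ∈ (Subtype.val '' A : Set (Fin q × ℝ × ℝ))
  · rw [Set.indicator_of_mem h, Set.indicator_of_mem (hiff.2 h)]
    simp [Real.sin_pi_sub]
  · rw [Set.indicator_of_notMem h, Set.indicator_of_notMem (fun h' => h (hiff.1 h'))]

/-- The oriented line carrying the outgoing ray: its direction and its signed distance from `0`. -/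
noncomputable def Phase.line (z : T.Phase) : ℂ × ℝ :=
  (z.dir, (z.foot * starRingEnd ℂ z.dir).im)

/-- The offsets of the lines with direction angle `u` carrying rays from `A`. -/
def shadow (A : Set T.Phase) (u : ℝ) : Set ℝ :=
  {p | (Complex.exp (u * Complex.I), p) ∈ Phase.line '' A}

/-- The phase points in coordinates `(α, s, u)`, with `u` the absolute direction angle. -/
noncomputable def absolute (A : Set T.Phase) : Set (Fin q × ℝ × ℝ) :=
  {x | (x.1, x.2.1, Complex.arg (Complex.exp (x.2.2 * Complex.I) / deriv (T.bdry x.1) x.2.1)) ∈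
    (Subtype.val '' A : Set (Fin q × ℝ × ℝ))}

theorem measurableSet_absolute {A : Set T.Phase} (hA : MeasurableSet A) :
    MeasurableSet (absolute A) := by
  have hd : Measurable fun x : Fin q × ℝ × ℝ => deriv (T.bdry x.1) x.2.1 :=
    T.measurable_deriv_bdry.comp (measurable_fst.prodMk (measurable_fst.comp measurable_snd))
  have : Measurable fun x : Fin q × ℝ × ℝ =>
      (x.1, x.2.1, Complex.arg (Complex.exp (x.2.2 * Complex.I) / deriv (T.bdry x.1) x.2.1)) := by
    refine measurable_fst.prodMk ((measurable_fst.comp measurable_snd).prodMk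
      (Complex.measurable_arg.comp (Measurable.div ?_ hd)))
    fun_prop
  exact this (T.measurableSet_phaseSet.subtype_image hA)

theorem Phase.Regular.norm_tangent {z : T.Phase} (h : z.Regular) : ‖z.tangent‖ = 1 :=
  norm_deriv_bdry z.2.1 h.1

/-- Regularity gives a unit tangent and an angle in (0, π), a range where `Complex.arg` recovers the
angle. -/
theorem mem_absolute_iff {A : Set T.Phase} (hA : ∀ z ∈ A, z.Regular) {α : Fin q} {s u : ℝ} :
    (α, s, u) ∈ absolute A ↔
      ∃ z ∈ A, z.comp = α ∧ z.coord = s ∧ z.dir = Complex.exp (u * Complex.I) := by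
  constructor
  · rintro ⟨(z : T.Phase), hz, he⟩
    have h1 : z.comp = α := congrArg (fun x => x.1) he
    have h2 : z.coord = s := congrArg (fun x => x.2.1) he
    have h3 : z.angle = Complex.arg (Complex.exp (u * Complex.I) / deriv (T.bdry α) s) :=
      congrArg (fun x => x.2.2) he
    refine ⟨z, hz, h1, h2, ?_⟩
    have ht : z.tangent = deriv (T.bdry α) s := by rw [Phase.tangent, h1, h2]
    rw [← ht] at h3
    have hn := (hA z hz).norm_tangent
    have hne : z.tangent ≠ 0 := fun h0 => by simp [h0] at hn
    have := Complex.norm_mul_exp_arg_mul_I (Complex.exp (u * Complex.I) / z.tangent)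
    rw [norm_div, hn, Complex.norm_exp_ofReal_mul_I, ← h3] at this
    rw [Phase.dir, show Complex.exp (z.angle * Complex.I) = Complex.exp (u * Complex.I) / z.tangent by
      simpa using this]
    field_simp
  · rintro ⟨z, hz, rfl, rfl, he⟩
    refine ⟨z, hz, ?_⟩
    have hn := (hA z hz).norm_tangent
    have hne : z.tangent ≠ 0 := fun h0 => by simp [h0] at hn
    have h3 : Complex.arg (Complex.exp (u * Complex.I) / z.tangent) = z.angle := by
      rw [← he, Phase.dir, mul_div_cancel_left₀ _ hne, Complex.arg_exp_mul_I]
      refine (toIocMod_eq_self _).2 ?_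
      have := (hA z hz).2
      constructor <;> linarith [this.1, this.2, Real.pi_pos]
    change z.1 = (z.1.1, z.1.2.1, Complex.arg (Complex.exp (u * Complex.I) / z.tangent))
    rw [h3]
    rfl

/-- The Jacobian of the offset of a line of direction angle `u` at a boundary point. -/
noncomputable def offsetDeriv (T : BilliardTable q) (x : Fin q × ℝ × ℝ) : ℝ :=
  (deriv (T.bdry x.1) x.2.1 * starRingEnd ℂ (Complex.exp (x.2.2 * Complex.I))).im

theorem measurable_offsetDeriv : Measurable T.offsetDeriv := by
  have hd : Measurable fun x : Fin q × ℝ × ℝ => deriv (T.bdry x.1) x.2.1 :=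
    T.measurable_deriv_bdry.comp (measurable_fst.prodMk (measurable_fst.comp measurable_snd))
  refine Complex.measurable_im.comp (hd.mul (Complex.continuous_conj.measurable.comp ?_))
  fun_prop

/-- At a fixed footpoint the substitution u = θ + arg τ, with τ the unit tangent, turns sin θ into
the absolute value of `offsetDeriv`; periodicity moves the interval of integration back to (-π, π].
-/
theorem lintegral_angle_eq {A : Set T.Phase} (hA : ∀ z ∈ A, z.Regular) (α : Fin q) (s : ℝ) :
    ∫⁻ θ, (Subtype.val '' A : Set (Fin q × ℝ × ℝ)).indicator
      (fun z => ENNReal.ofReal (Real.sin z.2.2)) (α, s, θ) =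
    ∫⁻ u in Set.Ioc (-Real.pi) Real.pi, (absolute A).indicator
      (fun x => ENNReal.ofReal |T.offsetDeriv x|) (α, s, u) := by
  by_cases hex : ∃ z ∈ A, z.comp = α ∧ z.coord = s
  · obtain ⟨z₀, hz₀, rfl, rfl⟩ := hex
    set α := z₀.comp
    set s := z₀.coord
    set τ := z₀.tangent with hτ
    have hn : ‖τ‖ = 1 := (hA z₀ hz₀).norm_tangent
    set a := Complex.arg τ with ha
    have hτa : τ = Complex.exp (a * Complex.I) := by
      have := Complex.norm_mul_exp_arg_mul_I τ
      rw [hn] at this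
      simpa using this.symm
    set H : ℝ → ENNReal := fun u => (absolute A).indicator
      (fun x => ENNReal.ofReal |T.offsetDeriv x|) (α, s, u) with hH
    have hexp : ∀ u : ℝ, Complex.exp (((u + 2 * Real.pi : ℝ) : ℂ) * Complex.I)
        = Complex.exp (u * Complex.I) := fun u => by
      push_cast
      rw [add_mul]
      exact Complex.exp_periodic _
    have hper : Function.Periodic H (2 * Real.pi) := fun u => by
      have h1 : (α, s, u + 2 * Real.pi) ∈ absolute A ↔ (α, s, u) ∈ absolute A := by
        simp only [absolute, Set.mem_ofPred_eq, hexp]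
      have h2 : T.offsetDeriv (α, s, u + 2 * Real.pi) = T.offsetDeriv (α, s, u) := by
        simp only [offsetDeriv, hexp]
      by_cases h : (α, s, u) ∈ absolute A
      · simp only [hH, Set.indicator_of_mem h, Set.indicator_of_mem (h1.2 h), h2]
      · simp only [hH, Set.indicator_of_notMem h, Set.indicator_of_notMem (fun h' => h (h1.1 h'))]
    have hshift : ∫⁻ u in Set.Ioc (-Real.pi) Real.pi, H u
        = ∫⁻ θ in Set.Ioc (-Real.pi) Real.pi, H (θ + a) := by
      have h1 := hper.setLIntegral_Ioc_eq Real.two_pi_pos (-Real.pi) (-Real.pi + a)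
      rw [show -Real.pi + 2 * Real.pi = Real.pi by ring,
        show -Real.pi + a + 2 * Real.pi = Real.pi + a by ring] at h1
      rw [h1, ← lintegral_indicator measurableSet_Ioc, ← lintegral_indicator measurableSet_Ioc,
        ← lintegral_add_right_eq_self _ a]
      refine lintegral_congr fun θ => ?_
      simp only [Set.indicator, Set.mem_Ioc, add_lt_add_iff_right, add_le_add_iff_right]
    rw [hshift, ← lintegral_indicator measurableSet_Ioc]
    refine lintegral_congr fun θ => ?_
    have hdiv : Complex.exp (((θ + a : ℝ) : ℂ) * Complex.I) / τ = Complex.exp (θ * Complex.I) := by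
      push_cast
      rw [hτa, add_mul, Complex.exp_add, mul_div_cancel_right₀ _ (Complex.exp_ne_zero _)]
    by_cases hθ : θ ∈ Set.Ioc (-Real.pi) Real.pi
    · rw [Set.indicator_of_mem hθ]
      have hiff : (α, s, θ + a) ∈ absolute A ↔
          (α, s, θ) ∈ (Subtype.val '' A : Set (Fin q × ℝ × ℝ)) := by
        change (α, s, Complex.arg (Complex.exp (((θ + a : ℝ) : ℂ) * Complex.I) / τ)) ∈
          (Subtype.val '' A : Set (Fin q × ℝ × ℝ)) ↔ _
        rw [hdiv, Complex.arg_exp_mul_I, (toIocMod_eq_self _).2]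
        rwa [show -Real.pi + 2 * Real.pi = Real.pi by ring]
      by_cases h : (α, s, θ) ∈ (Subtype.val '' A : Set (Fin q × ℝ × ℝ))
      · rw [Set.indicator_of_mem h]
        simp only [hH]
        rw [Set.indicator_of_mem (hiff.2 h)]
        have hsin : 0 ≤ Real.sin θ := by
          obtain ⟨z, hz, he⟩ := h
          have := (hA z hz).2
          rw [Phase.angle, he] at this
          exact (Real.sin_pos_of_mem_Ioo this).le
        have : T.offsetDeriv (α, s, θ + a) = -Real.sin θ := by
          change (τ * starRingEnd ℂ (Complex.exp (((θ + a : ℝ) : ℂ) * Complex.I))).im = _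
          have hee : Complex.exp (((θ + a : ℝ) : ℂ) * Complex.I) = τ * Complex.exp (θ * Complex.I) := by
            rw [← hdiv]
            have : τ ≠ 0 := fun h0 => by simp [h0] at hn
            field_simp
          rw [hee, map_mul, ← mul_assoc, Complex.mul_conj, Complex.normSq_eq_norm_sq, hn]
          simp [Complex.exp_ofReal_mul_I_im]
        rw [this, abs_neg, abs_of_nonneg hsin]
      · rw [Set.indicator_of_notMem h]
        simp only [hH]
        rw [Set.indicator_of_notMem (fun h' => h (hiff.1 h'))]
    · rw [Set.indicator_of_notMem hθ, Set.indicator_of_notMem]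
      rintro ⟨z, hz, he⟩
      have := (hA z hz).2
      rw [Phase.angle, he] at this
      exact hθ ⟨by linarith [this.1, Real.pi_pos], this.2.le⟩
  · have h1 : ∀ θ, (α, s, θ) ∉ (Subtype.val '' A : Set (Fin q × ℝ × ℝ)) := by
      rintro θ ⟨z, hz, he⟩
      exact hex ⟨z, hz, congrArg (fun x => x.1) he, congrArg (fun x => x.2.1) he⟩
    have h2 : ∀ u, (α, s, u) ∉ absolute A := fun u hu => by
      obtain ⟨z, hz, h, h', -⟩ := (mem_absolute_iff hA).1 hu
      exact hex ⟨z, hz, h, h'⟩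
    simp only [Set.indicator_of_notMem (h1 _), Set.indicator_of_notMem (h2 _), lintegral_zero]

theorem hasDerivAt_offset {α : Fin q} {s : ℝ} (h : ContDiffAt ℝ 1 (T.bdry α) s) (d : ℂ) :
    HasDerivAt (fun s => (T.bdry α s * starRingEnd ℂ d).im)
      (deriv (T.bdry α) s * starRingEnd ℂ d).im s := by
  have h1 := ((h.differentiableAt one_ne_zero).hasDerivAt.mul_const (starRingEnd ℂ d))
  exact Complex.imCLM.hasFDerivAt.comp_hasDerivAt s h1

/-- For a fixed direction, `offsetDeriv` is the derivative of the offset along the boundary.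
Injectivity of `Phase.line` makes the offset injective on each component and its images disjoint, so
the one-dimensional change of variables adds up to the measure of the shadow. -/
theorem sum_lintegral_offset_eq {A : Set T.Phase} (hAm : MeasurableSet A) (hA : ∀ z ∈ A, z.Regular)
    (hinj : Set.InjOn Phase.line A) (u : ℝ) :
    ∑ α, ∫⁻ s, (absolute A).indicator (fun x => ENNReal.ofReal |T.offsetDeriv x|) (α, s, u) =
      volume (shadow A u) := by
  set d := Complex.exp (u * Complex.I) with hd
  set S : Fin q → Set ℝ := fun α => {s | (α, s, u) ∈ absolute A} with hS
  set h : Fin q → ℝ → ℝ := fun α s => (T.bdry α s * starRingEnd ℂ d).im with hh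
  have hSm : ∀ α, MeasurableSet (S α) := fun α =>
    (measurable_prodMk_left.comp measurable_prodMk_right) (measurableSet_absolute hAm)
  have hline : ∀ z : T.Phase, z.dir = d → z.line = (d, h z.comp z.coord) := fun z hz => by
    rw [Phase.line, hz]; rfl
  have hSi : ∀ α β, ∀ s ∈ S α, ∀ s' ∈ S β, h α s = h β s' → (α, s) = (β, s') := by
    intro α β s hs s' hs' he
    obtain ⟨z, hz, rfl, rfl, hzd⟩ := (mem_absolute_iff hA).1 hs
    obtain ⟨z', hz', rfl, rfl, hzd'⟩ := (mem_absolute_iff hA).1 hs'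
    rw [hinj hz hz' (by rw [hline z hzd, hline z' hzd', he])]
  have hSinj : ∀ α, Set.InjOn (h α) (S α) := fun α s hs s' hs' he =>
    congrArg Prod.snd (hSi α α s hs s' hs' he)
  have hint : ∀ α, ∫⁻ s, (absolute A).indicator (fun x => ENNReal.ofReal |T.offsetDeriv x|) (α, s, u)
      = volume (h α '' S α) := fun α => by
    have := lintegral_image_eq_lintegral_abs_deriv_mul (hSm α)
      (f := h α) (f' := fun s => T.offsetDeriv (α, s, u)) (fun s hs => ?_) (hSinj α) (fun _ => 1)
    · rw [setLIntegral_one] at this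
      rw [this, ← lintegral_indicator (hSm α)]
      refine lintegral_congr fun s => ?_
      simp only [Set.indicator, mul_one]
      rfl
    · obtain ⟨z, hz, rfl, rfl, -⟩ := (mem_absolute_iff hA).1 hs
      exact (hasDerivAt_offset (hA z hz).1 d).hasDerivWithinAt
  have hhm : ∀ α, Measurable (h α) := fun α =>
    (Complex.continuous_im.comp ((T.continuous_bdry α).mul continuous_const)).measurable
  have hunion : shadow A u = ⋃ α, h α '' S α := by
    ext p
    simp only [Set.mem_iUnion, Set.mem_image]
    constructor
    · rintro ⟨z, hz, he⟩
      have hzd : z.dir = d := congrArg Prod.fst he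
      rw [hline z hzd] at he
      exact ⟨z.comp, z.coord, (mem_absolute_iff hA).2 ⟨z, hz, rfl, rfl, hzd⟩, congrArg Prod.snd he⟩
    · rintro ⟨α, s, hs, rfl⟩
      obtain ⟨z, hz, rfl, rfl, hzd⟩ := (mem_absolute_iff hA).1 hs
      exact ⟨z, hz, hline z hzd⟩
  rw [hunion, measure_iUnion, tsum_fintype, Finset.sum_congr rfl fun α _ => hint α]
  · intro α β hαβ
    refine Set.disjoint_left.2 ?_
    rintro _ ⟨s, hs, rfl⟩ ⟨s', hs', he⟩
    exact hαβ (congrArg Prod.fst (hSi α β s hs s' hs' he.symm))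
  · exact fun α => (hSm α).image_of_measurable_injOn (hhm α) (hSinj α)

/-- The Liouville measure is the measure of the set of lines. -/
theorem liouville_eq_lintegral_shadow {A : Set T.Phase} (hAm : MeasurableSet A)
    (hA : ∀ z ∈ A, z.Regular) (hinj : Set.InjOn Phase.line A) :
    T.liouville A = ∫⁻ u in Set.Ioc (-Real.pi) Real.pi, volume (shadow A u) := by
  have hm : Measurable ((absolute A).indicator fun x => ENNReal.ofReal |T.offsetDeriv x|) :=
    (ENNReal.measurable_ofReal.comp measurable_offsetDeriv.abs).indicator (measurableSet_absolute hAm)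
  rw [liouville_apply hAm]
  simp only [lintegral_angle_eq hA, ← sum_lintegral_offset_eq hAm hA hinj]
  have hm' : ∀ α, Measurable fun x : ℝ × ℝ =>
      (absolute A).indicator (fun x => ENNReal.ofReal |T.offsetDeriv x|) (α, x.1, x.2) := fun α =>
    hm.comp measurable_prodMk_left
  rw [lintegral_finsetSum]
  · refine Finset.sum_congr rfl fun α _ => ?_
    rw [lintegral_lintegral_swap (hm' α).aemeasurable]
  · exact fun α _ => (hm' α).lintegral_prod_left'

end BilliardTable

/-! ### Invariance of the Liouville measure and the null exceptional sets -/

namespace BilliardTable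

variable {q : ℕ} {T : BilliardTable q}

/-- The coordinate of a point along the direction `d`. -/
noncomputable def along (d x : ℂ) : ℝ := (x * starRingEnd ℂ d).re

theorem along_add {d x : ℂ} (hd : ‖d‖ = 1) (t : ℝ) : along d (x + t * d) = along d x + t := by
  rw [along, add_mul, mul_assoc, Complex.mul_conj, Complex.normSq_eq_norm_sq, hd]
  simp [along]

theorem offset_add {d x : ℂ} (t : ℝ) : ((x + t * d) * starRingEnd ℂ d).im =
    (x * starRingEnd ℂ d).im := by
  rw [add_mul, mul_assoc, Complex.mul_conj]
  simp

/-- The chord from `z` to the boundary point with parameters `x` passes the level `r`. -/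
def Crosses (r : ℝ) (p : T.Phase × (Fin q × ℝ)) : Prop :=
  along p.1.dir p.1.foot < r ∧ r < along p.1.dir (T.bdry p.2.1 p.2.2)

theorem measurableSet_crosses (r : ℝ) :
    MeasurableSet {p : T.Phase × (Fin q × ℝ) | Crosses r p} := by
  have hal : Measurable fun x : ℂ × ℂ => along x.1 x.2 :=
    (Complex.continuous_re.comp
      (continuous_snd.mul (Complex.continuous_conj.comp continuous_fst))).measurable
  have hd : Measurable fun p : T.Phase × (Fin q × ℝ) => p.1.dir := measurable_dir.comp measurable_fst
  exact (measurableSet_lt (hal.comp (hd.prodMk (measurable_foot.comp measurable_fst)))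
    measurable_const).inter (measurableSet_lt measurable_const
      (hal.comp (hd.prodMk (T.measurable_bdry.comp measurable_snd))))

/-- A chord has positive length, so it passes a rational level; the rational levels give the
countable decomposition of phase space. -/
theorem Hits.exists_crosses {z : T.Phase} {x : Fin q × ℝ} (h : Hits z x) :
    ∃ r : ℚ, Crosses (r : ℝ) (z, x) := by
  obtain ⟨hz, -, t, ht, hf, -⟩ := h
  have h1 : along z.dir z.foot < along z.dir (T.bdry x.1 x.2) := by
    rw [hf, along_add hz.norm_dir]
    linarith
  obtain ⟨r, hr⟩ := exists_rat_btwn h1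
  exact ⟨r, hr⟩

theorem foot_eq_of_line_eq {z z' : T.Phase} (hz : z.Regular) (h : z.line = z'.line) :
    z'.foot = z.foot + ((along z.dir z'.foot - along z.dir z.foot : ℝ) : ℂ) * z.dir := by
  have hd : z.dir = z'.dir := congrArg Prod.fst h
  have hp : (z.foot * starRingEnd ℂ z.dir).im = (z'.foot * starRingEnd ℂ z.dir).im := by
    have := congrArg Prod.snd h
    simp only [Phase.line] at this
    rwa [← hd] at this
  have h1 : z'.foot * starRingEnd ℂ z.dir = z.foot * starRingEnd ℂ z.dir +
      ((along z.dir z'.foot - along z.dir z.foot : ℝ) : ℂ) := by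
    apply Complex.ext
    · simp [along]
    · simp [hp]
  have h2 : starRingEnd ℂ z.dir * z.dir = 1 := by
    rw [mul_comm, Complex.mul_conj, Complex.normSq_eq_norm_sq, hz.norm_dir]
    norm_num
  have h3 := congrArg (· * z.dir) h1
  simp only [add_mul, mul_assoc, h2, mul_one] at h3
  exact h3

/-- A second footpoint ahead of the first but behind the level r would lie on the open chord, hence
inside the domain, although it is a boundary point. -/
theorem Hits.not_along_lt {z z' : T.Phase} {x x' : Fin q × ℝ} {r : ℝ} (h : Hits z x)
    (hr : Crosses r (z, x)) (hr' : Crosses r (z', x')) (hl : z.line = z'.line) :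
    ¬ along z.dir z.foot < along z.dir z'.foot := fun hlt => by
  obtain ⟨hz, -, t, ht, hf, hd⟩ := h
  have hd' : z.dir = z'.dir := congrArg Prod.fst hl
  have h1 : r < along z.dir z.foot + t := by
    rw [← along_add hz.norm_dir, ← hf]; exact hr.2
  have h2 : along z.dir z'.foot < r := by rw [hd']; exact hr'.1
  have h3 := hd (along z.dir z'.foot - along z.dir z.foot) ⟨by linarith, by linarith⟩
  rw [← foot_eq_of_line_eq hz hl] at h3
  exact bdry_notMem_domain _ _ h3

theorem eq_of_foot_eq {z z' : T.Phase} (hz : z.Regular) (hf : z.foot = z'.foot)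
    (hd : z.dir = z'.dir) : z = z' := by
  have h1 : (z.comp, z.coord) = (z'.comp, z'.coord) := bdry_injective z.2.1 z'.2.1 hf
  obtain ⟨hc, hs⟩ : z.comp = z'.comp ∧ z.coord = z'.coord := Prod.mk.inj h1
  have ht : z.tangent = z'.tangent := by rw [Phase.tangent, Phase.tangent, hc, hs]
  have hne : z.tangent ≠ 0 := fun h0 => by simpa [h0] using hz.norm_tangent
  have he : Complex.exp (z.angle * Complex.I) = Complex.exp (z'.angle * Complex.I) := by
    rw [Phase.dir, Phase.dir, ← ht] at hd
    exact mul_left_cancel₀ hne hd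
  have hre := congrArg Complex.re he
  simp only [Complex.exp_ofReal_mul_I_re] at hre
  have ha : z.angle = z'.angle := Real.injOn_cos z.2.2 z'.2.2 hre
  exact Subtype.ext (Prod.ext hc (Prod.ext hs ha))

/-- A point of an oriented line lies on at most one chord. -/
theorem injOn_line_of_crosses {A : Set T.Phase} {r : ℝ}
    (hA : ∀ z ∈ A, ∃ x, Hits z x ∧ Crosses r (z, x)) : Set.InjOn Phase.line A := by
  intro z hz z' hz' hl
  obtain ⟨x, hx, hr⟩ := hA z hz
  obtain ⟨x', hx', hr'⟩ := hA z' hz'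
  have hd : z.dir = z'.dir := congrArg Prod.fst hl
  have h1 := hx.not_along_lt hr hr' hl
  have h2 := hx'.not_along_lt hr' hr hl.symm
  rw [← hd] at h2
  have h3 := foot_eq_of_line_eq hx.1 hl
  rw [le_antisymm (not_lt.1 h1) (not_lt.1 h2), sub_self, Complex.ofReal_zero, zero_mul, add_zero] at h3
  exact eq_of_foot_eq hx.1 h3.symm hd

theorem measurableSet_billiardMap_image {A : Set T.Phase} (hA : MeasurableSet A)
    (hAD : ∀ z ∈ A, ∃ w, Collides z w) : MeasurableSet (billiardMap '' A) :=
  hA.image_of_measurable_injOn measurable_billiardMap (injOn_billiardMap.mono hAD)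

theorem Collides.line_rev {z w : T.Phase} (h : Collides z w) : w.rev.line = -z.line := by
  obtain ⟨t, -, hf, -⟩ := h.2.2.1
  have hf : w.rev.foot = z.foot + t * z.dir := hf
  rw [Phase.line, Phase.line, h.dir_rev, hf, map_neg, mul_neg, Complex.neg_im, offset_add]
  rfl

theorem shadow_periodic (A : Set T.Phase) (u : ℝ) : shadow A (u + 2 * Real.pi) = shadow A u := by
  have : Complex.exp (((u + 2 * Real.pi : ℝ) : ℂ) * Complex.I) = Complex.exp (u * Complex.I) := by
    push_cast
    rw [add_mul]
    exact Complex.exp_periodic _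
  simp only [shadow, this]

/-- The reversed image C carries the lines of A with opposite orientation, so its shadow at u is the
negative of the shadow of A at u + π. Lebesgue measure is invariant under negation, the integral
over u under translation by half a period, and the Liouville measure under reversal. -/
theorem liouville_image_of_crosses {A : Set T.Phase} (hAm : MeasurableSet A)
    (hAD : ∀ z ∈ A, ∃ w, Collides z w) {r : ℝ}
    (hA : ∀ z ∈ A, ∃ x, Hits z x ∧ Crosses r (z, x)) :
    T.liouville (billiardMap '' A) = T.liouville A := by
  have hinj := injOn_line_of_crosses hA
  have hreg : ∀ z ∈ A, z.Regular := fun z hz => (hAD z hz).choose_spec.1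
  set C : Set T.Phase := Phase.rev ⁻¹' (billiardMap '' A) with hC
  have himm := measurableSet_billiardMap_image hAm hAD
  have hCm : MeasurableSet C := measurable_rev himm
  have hspec : ∀ w ∈ C, ∃ z ∈ A, Collides z w.rev ∧ w.line = -z.line := by
    rintro w ⟨z, hz, he⟩
    obtain ⟨v, hv⟩ := hAD z hz
    rw [billiardMap_of_collides hv] at he
    subst he
    exact ⟨z, hz, hv, by simpa using hv.line_rev⟩
  have hCreg : ∀ w ∈ C, w.Regular := fun w hw => by
    obtain ⟨z, -, hc, -⟩ := hspec w hw
    simpa using hc.2.1.rev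
  have hCinj : Set.InjOn Phase.line C := by
    intro w hw w' hw' he
    obtain ⟨z, hz, hc, hl⟩ := hspec w hw
    obtain ⟨z', hz', hc', hl'⟩ := hspec w' hw'
    rw [hl, hl', neg_inj] at he
    have := hinj hz hz' he
    subst this
    exact Phase.rev_injective (hc.unique hc')
  have hsh : ∀ u, shadow C u = Neg.neg ⁻¹' shadow A (u + Real.pi) := fun u => by
    have hexp : Complex.exp (((u + Real.pi : ℝ) : ℂ) * Complex.I) = -Complex.exp (u * Complex.I) := by
      push_cast
      rw [add_mul, Complex.exp_add, Complex.exp_pi_mul_I]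
      ring
    ext p
    simp only [shadow, Set.mem_preimage, Set.mem_ofPred_eq, hexp]
    constructor
    · rintro ⟨w, hw, he⟩
      obtain ⟨z, hz, -, hl⟩ := hspec w hw
      refine ⟨z, hz, ?_⟩
      rw [← neg_neg z.line, ← hl, he]
      rfl
    · rintro ⟨z, hz, he⟩
      obtain ⟨v, hv⟩ := hAD z hz
      refine ⟨v.rev, ⟨z, hz, by rw [billiardMap_of_collides hv, Phase.rev_rev]⟩, ?_⟩
      rw [hv.line_rev, he]
      simp
  rw [← liouville_preimage_rev himm, liouville_eq_lintegral_shadow hCm hCreg hCinj,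
    liouville_eq_lintegral_shadow hAm hreg hinj]
  have hvol : ∀ u, volume (shadow C u) = volume (shadow A (u + Real.pi)) := fun u => by
    rw [hsh, Measure.measure_preimage_neg]
  simp only [hvol]
  have hper : Function.Periodic (fun u => volume (shadow A u)) (2 * Real.pi) := fun u => by
    simp only [shadow_periodic]
  have h1 := hper.setLIntegral_Ioc_eq Real.two_pi_pos (-Real.pi) 0
  rw [show -Real.pi + 2 * Real.pi = Real.pi by ring, zero_add] at h1
  rw [h1, ← lintegral_indicator measurableSet_Ioc, ← lintegral_indicator measurableSet_Ioc,
    ← lintegral_add_right_eq_self (fun u => (Set.Ioc 0 (2 * Real.pi)).indicator _ u) Real.pi]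
  refine lintegral_congr fun u => ?_
  have hmem : u + Real.pi ∈ Set.Ioc 0 (2 * Real.pi) ↔ u ∈ Set.Ioc (-Real.pi) Real.pi := by
    constructor <;> rintro ⟨h1, h2⟩ <;> constructor <;> linarith
  by_cases hu : u ∈ Set.Ioc (-Real.pi) Real.pi
  · rw [Set.indicator_of_mem hu, Set.indicator_of_mem (hmem.2 hu)]
  · rw [Set.indicator_of_notMem hu, Set.indicator_of_notMem (fun h => hu (hmem.1 h))]

/-- The billiard map preserves the Liouville measure on its domain. -/
theorem liouville_image {A : Set T.Phase} (hAm : MeasurableSet A)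
    (hAD : ∀ z ∈ A, ∃ w, Collides z w) : T.liouville (billiardMap '' A) = T.liouville A := by
  obtain ⟨e, he⟩ := exists_surjective_nat ℚ
  -- The pieces consist of chords passing a common rational level. After they are made disjoint,
  -- injectivity of the billiard map keeps the images disjoint, so the measures add up.
  set R : ℕ → Set T.Phase := fun n => A ∩ {z | ∃ x, Hits z x ∧ Crosses (e n : ℝ) (z, x)} with hR
  have hRm : ∀ n, MeasurableSet (R n) := fun n =>
    hAm.inter (measurableSet_exists_hits (measurableSet_crosses _))
  have hU : ⋃ n, disjointed R n = A := by
    rw [iUnion_disjointed]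
    refine Set.Subset.antisymm (Set.iUnion_subset fun n => Set.inter_subset_left) fun z hz => ?_
    obtain ⟨w, hw⟩ := hAD z hz
    obtain ⟨r, hr⟩ := hw.hits.exists_crosses
    obtain ⟨n, rfl⟩ := he r
    exact Set.mem_iUnion.2 ⟨n, hz, _, hw.hits, hr⟩
  have hdm : ∀ n, MeasurableSet (disjointed R n) := fun n => .disjointed hRm n
  have hsub : ∀ n, disjointed R n ⊆ R n := disjointed_subset R
  have hD : ∀ n, ∀ z ∈ disjointed R n, ∃ w, Collides z w := fun n z hz => hAD z (hsub n hz).1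
  have h1 : ∀ n, T.liouville (billiardMap '' disjointed R n) = T.liouville (disjointed R n) :=
    fun n => liouville_image_of_crosses (hdm n) (hD n) fun z hz => (hsub n hz).2
  rw [← hU, Set.image_iUnion, measure_iUnion, measure_iUnion (disjoint_disjointed R) hdm]
  · exact tsum_congr h1
  · intro m n hmn
    refine (disjoint_disjointed R hmn).image injOn_billiardMap (hD m) (hD n)
  · exact fun n => measurableSet_billiardMap_image (hdm n) (hD n)

/-- For a fixed direction, a tangential arrival makes the offset a critical value of the offset
function on a smooth part of the boundary. Critical values form a null set, so on each piece of
constant level the shadows are null. -/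
theorem liouville_tangential_eq_zero :
    T.liouville {z | ∃ x, Hits z x ∧ ContDiffAt ℝ 1 (T.bdry x.1) x.2 ∧
      (z.dir / deriv (T.bdry x.1) x.2).im = 0} = 0 := by
  set P : T.Phase × (Fin q × ℝ) → Prop := fun p => ContDiffAt ℝ 1 (T.bdry p.2.1) p.2.2 ∧
      (p.1.dir / deriv (T.bdry p.2.1) p.2.2).im = 0 with hP
  have hPm : MeasurableSet {p | P p} := (measurable_snd T.measurableSet_smooth).inter
    (Complex.measurable_im.comp ((measurable_dir.comp measurable_fst).div
      (T.measurable_deriv_bdry.comp measurable_snd)) (measurableSet_singleton 0))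
  have hcov : {z | ∃ x, Hits z x ∧ ContDiffAt ℝ 1 (T.bdry x.1) x.2 ∧
      (z.dir / deriv (T.bdry x.1) x.2).im = 0} ⊆
      ⋃ r : ℚ, {z | ∃ x, Hits z x ∧ (P (z, x) ∧ Crosses (r : ℝ) (z, x))} := by
    rintro z ⟨x, hx, h⟩
    obtain ⟨r, hr⟩ := hx.exists_crosses
    exact Set.mem_iUnion.2 ⟨r, x, hx, h, hr⟩
  refine measure_mono_null hcov (measure_iUnion_null fun r => ?_)
  rw [liouville_eq_lintegral_shadow
    (measurableSet_exists_hits (P := fun p => P p ∧ Crosses (r : ℝ) p)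
      (hPm.inter (measurableSet_crosses _)))
    (fun z ⟨x, hx, _⟩ => hx.1) (injOn_line_of_crosses fun z ⟨x, hx, _, hr⟩ => ⟨x, hx, hr⟩)]
  refine (lintegral_congr fun u => ?_).trans lintegral_zero
  set d := Complex.exp (u * Complex.I) with hd
  set h : Fin q → ℝ → ℝ := fun α s => (T.bdry α s * starRingEnd ℂ d).im with hh
  set S : Fin q → Set ℝ := fun α => {s | ContDiffAt ℝ 1 (T.bdry α) s ∧
    (deriv (T.bdry α) s * starRingEnd ℂ d).im = 0} with hS
  have hnull : ∀ α, volume (h α '' S α) = 0 := fun α => by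
    refine addHaar_image_eq_zero_of_det_fderivWithin_eq_zero volume
      (f' := fun _ => ContinuousLinearMap.toSpanSingleton ℝ (0 : ℝ)) (fun s hs => ?_) (fun s _ => by simp)
    have h1 := (hasDerivAt_offset hs.1 d).hasDerivWithinAt (s := S α)
    rw [hs.2] at h1
    exact h1.hasFDerivWithinAt
  refine measure_mono_null (fun p hp => ?_) (measure_iUnion_null hnull)
  obtain ⟨z, ⟨x, hx, ⟨hx1, hx2⟩, -⟩, he⟩ := hp
  have hzd : z.dir = d := congrArg Prod.fst he
  have hzp : (z.foot * starRingEnd ℂ z.dir).im = p := congrArg Prod.snd he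
  refine Set.mem_iUnion.2 ⟨x.1, x.2, ⟨hx1, ?_⟩, ?_⟩
  · have hne := deriv_bdry_ne_zero hx1
    change (z.dir / deriv (T.bdry x.1) x.2).im = 0 at hx2
    have hre : ((z.dir / deriv (T.bdry x.1) x.2).re : ℂ) = z.dir / deriv (T.bdry x.1) x.2 :=
      Complex.ext rfl (by simp [hx2])
    have hdd : d = (z.dir / deriv (T.bdry x.1) x.2).re * deriv (T.bdry x.1) x.2 := by
      rw [hre, ← hzd]; field_simp
    rw [hdd, map_mul, Complex.conj_ofReal, mul_left_comm, Complex.mul_conj, ← Complex.ofReal_mul,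
      Complex.ofReal_im]
  · obtain ⟨-, -, t, -, hf, -⟩ := hx
    change (T.bdry x.1 x.2 * starRingEnd ℂ d).im = p
    rw [hf, ← hzd, offset_add, hzp]

theorem liouville_not_regular_eq_zero : T.liouville {z | ¬ z.Regular} = 0 := by
  refine liouville_eq_zero_of_sections measurableSet_regular.compl fun α => ?_
  obtain ⟨F, hF⟩ := T.exists_finset_corners α
  have hae : ∀ᵐ s : ℝ, s ∉ (F : Set ℝ) := by
    rw [ae_iff]
    simpa using F.finite_toSet.measure_zero volume
  refine hae.mono fun s hs => ?_
  refine measure_mono_null (t := {0, Real.pi}) ?_ ((Set.toFinite _).measure_zero volume)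
  rintro θ ⟨(z : T.Phase), hz, he⟩
  by_contra hθ
  have hθ' : θ ≠ 0 ∧ θ ≠ Real.pi := by simpa using hθ
  have hz1 : T.bdry z.comp = T.bdry α := by rw [Phase.comp, he]
  have hz2 : z.coord = s := by rw [Phase.coord, he]
  have hz3 : z.angle = θ := by rw [Phase.angle, he]
  have hs0 : s ∈ Set.Ico 0 (T.len α) := by have := z.2.1; rwa [he] at this
  have hθ0 : θ ∈ Set.Icc 0 Real.pi := by have := z.2.2; rwa [he] at this
  refine hz ⟨?_, ?_⟩
  · rw [hz1, hz2]; exact (hF s hs0).1 hs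
  · rw [hz3]; exact ⟨lt_of_le_of_ne hθ0.1 hθ'.1.symm, lt_of_le_of_ne hθ0.2 hθ'.2⟩

/-- From each footpoint at most one outgoing direction aims at c, so every angular section has at
most one element. -/
theorem liouville_toward_eq_zero (c : ℂ) :
    T.liouville {z | z.Regular ∧ c - z.foot ≠ 0 ∧ c - z.foot = (‖c - z.foot‖ : ℝ) * z.dir} = 0 := by
  have hm := measurable_foot (T := T).const_sub c
  refine liouville_eq_zero_of_sections (measurableSet_regular.inter (.inter
    (hm (measurableSet_singleton 0)).compl (measurableSet_eq_fun hm
      ((Complex.measurable_ofReal.comp hm.norm).mul measurable_dir)))) fun α => ?_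
  refine Eventually.of_forall fun s => Set.Subsingleton.measure_zero ?_ volume
  rintro θ ⟨(z : T.Phase), ⟨hz, hz0, hz1⟩, he⟩ θ' ⟨(z' : T.Phase), ⟨hz', hz0', hz1'⟩, he'⟩
  have hf : z.foot = z'.foot := by
    rw [Phase.foot, Phase.foot, Phase.comp, Phase.comp, Phase.coord, Phase.coord, he, he']
  have hd : z.dir = z'.dir := by
    have hne : ((‖c - z.foot‖ : ℝ) : ℂ) ≠ 0 := by
      exact_mod_cast (norm_pos_iff.2 hz0).ne'
    rw [← hf] at hz1'
    exact mul_left_cancel₀ hne (hz1.symm.trans hz1')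
  have := eq_of_foot_eq hz hf hd
  rw [this, he'] at he
  exact (congrArg (fun x => x.2.2) he).symm

theorem ae_exists_collides : ∀ᵐ z ∂T.liouville, ∃ w, Collides z w := by
  choose F hF using T.exists_finset_corners
  set C : Set ℂ := ⋃ α, T.bdry α '' F α with hC
  have hCc : C.Countable := Set.countable_iUnion fun α => (F α).countable_toSet.image _
  have h1 : ∀ᵐ z ∂T.liouville, z.Regular := ae_iff.2 liouville_not_regular_eq_zero
  have h2 : ∀ᵐ z ∂T.liouville, ∀ c ∈ C,
      ¬ (z.Regular ∧ c - z.foot ≠ 0 ∧ c - z.foot = (‖c - z.foot‖ : ℝ) * z.dir) :=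
    (ae_ball_iff hCc).2 fun c _ => ae_iff.2 (by simpa only [not_not] using liouville_toward_eq_zero c)
  have h3 : ∀ᵐ z ∂T.liouville, ¬ ∃ x, Hits z x ∧ ContDiffAt ℝ 1 (T.bdry x.1) x.2 ∧
      (z.dir / deriv (T.bdry x.1) x.2).im = 0 :=
    ae_iff.2 (by simpa only [not_not] using liouville_tangential_eq_zero)
  filter_upwards [h1, h2, h3] with z hz hcor htan
  obtain ⟨x, hx⟩ := hz.exists_hits
  have hsm : ContDiffAt ℝ 1 (T.bdry x.1) x.2 := by
    refine (hF x.1 x.2 hx.2.1).1 fun hmem => ?_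
    obtain ⟨h1, -, h2, h3, -⟩ := hits_iff.1 hx
    exact hcor _ (Set.mem_iUnion.2 ⟨x.1, x.2, hmem, rfl⟩) ⟨h1, h2, h3⟩
  exact hx.exists_collides hsm fun h0 => htan ⟨x, hx, hsm, h0⟩

theorem liouville_preimage_le {B : Set T.Phase} (hB : MeasurableSet B) :
    T.liouville (billiardMap ⁻¹' B) ≤ T.liouville B := by
  have hm : MeasurableSet (billiardMap ⁻¹' B ∩ {z : T.Phase | ∃ w, Collides z w}) :=
    (measurable_billiardMap hB).inter measurableSet_collisionDomain
  calc T.liouville (billiardMap ⁻¹' B)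
      = T.liouville (billiardMap ⁻¹' B ∩ {z : T.Phase | ∃ w, Collides z w}) :=
        (measure_inter_conull (ae_iff.1 ae_exists_collides)).symm
    _ = T.liouville (billiardMap '' (billiardMap ⁻¹' B ∩ {z : T.Phase | ∃ w, Collides z w})) :=
        (liouville_image hm fun z hz => hz.2).symm
    _ ≤ T.liouville B := measure_mono (by rintro _ ⟨z, hz, rfl⟩; exact hz.1)

/-- The pushforward is dominated by the Liouville measure and has the same finite total mass, so the
two agree. Surjectivity up to a null set need not be shown separately. -/
theorem measurePreserving_billiardMap :
    MeasurePreserving billiardMap T.liouville T.liouville := by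
  refine ⟨measurable_billiardMap, ?_⟩
  refine Measure.eq_of_le_of_measure_univ_eq (Measure.le_iff.2 fun B hB => ?_) ?_
  · rw [Measure.map_apply measurable_billiardMap hB]
    exact liouville_preimage_le hB
  · rw [Measure.map_apply measurable_billiardMap .univ, Set.preimage_univ]

/-! ### Mean values and conclusion -/

theorem integrable_and_average_mem {f : T.Phase → ℝ} (hf : Measurable f) {C : ℝ}
    (hC : ∀ z, f z ∈ Set.Icc 0 C) : Integrable f T.liouville ∧
      0 ≤ (∫ z, f z ∂T.liouville) / T.liouville.real Set.univ ∧
      (∫ z, f z ∂T.liouville) / T.liouville.real Set.univ ≤ C := by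
  have hi : Integrable f T.liouville := Integrable.of_bound hf.aestronglyMeasurable C
    (Eventually.of_forall fun z => by rw [Real.norm_of_nonneg (hC z).1]; exact (hC z).2)
  have hpos : 0 < T.liouville.real Set.univ := ENNReal.toReal_pos T.liouville_univ_ne_zero
    (measure_ne_top _ _)
  refine ⟨hi, div_nonneg (integral_nonneg fun z => (hC z).1) hpos.le, ?_⟩
  rw [div_le_iff₀ hpos]
  calc ∫ z, f z ∂T.liouville ≤ ∫ _, C ∂T.liouville :=
        integral_mono hi (integrable_const C) fun z => (hC z).2
    _ = C * T.liouville.real Set.univ := by rw [integral_const, smul_eq_mul, mul_comm]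

theorem rotationVector_mem (z : T.Phase) (α : Fin q) : rotationVector z α ∈ Set.Icc 0 1 := by
  have h := footpointGain_mem z α
  exact ⟨div_nonneg h.1 (T.len_pos α).le, (div_le_one (T.len_pos α)).2 h.2⟩

end BilliardTable
theorem mainTheorem5 (q : ℕ) (T : BilliardTable q) :
    -- the phase space has positive finite measure, so that mean values make sense
    (T.liouville Set.univ ≠ 0 ∧ T.liouville Set.univ ≠ ⊤) ∧
    -- existence almost everywhere
    (∀ᵐ z ∂T.liouville, BilliardTable.GainExists z) ∧
    MeasurableSet {z : T.Phase | BilliardTable.GainExists z} ∧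
    -- invariance of the set on which the vectors exist
    (∀ z : T.Phase, BilliardTable.GainExists (BilliardTable.billiardMap z) ↔
      BilliardTable.GainExists z) ∧
    -- the footpoint gain vector
    (Measurable (BilliardTable.footpointGain (T := T)) ∧
      (∀ z : T.Phase, BilliardTable.footpointGain (BilliardTable.billiardMap z) =
        BilliardTable.footpointGain z) ∧
      (∀ (z : T.Phase) (α : Fin q), 0 ≤ BilliardTable.footpointGain z α ∧
        BilliardTable.footpointGain z α ≤ T.len α) ∧
      (∀ α : Fin q,
        Integrable (fun z : T.Phase => BilliardTable.footpointGain z α) T.liouville ∧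
        0 ≤ (∫ z, BilliardTable.footpointGain z α ∂T.liouville) / T.liouville.real Set.univ ∧
        (∫ z, BilliardTable.footpointGain z α ∂T.liouville) / T.liouville.real Set.univ
          ≤ T.len α)) ∧
    -- the rotation vector
    (Measurable (BilliardTable.rotationVector (T := T)) ∧
      (∀ z : T.Phase, BilliardTable.rotationVector (BilliardTable.billiardMap z) =
        BilliardTable.rotationVector z) ∧
      (∀ (z : T.Phase) (α : Fin q), 0 ≤ BilliardTable.rotationVector z α ∧
        BilliardTable.rotationVector z α ≤ 1) ∧
      (∀ α : Fin q,
        Integrable (fun z : T.Phase => BilliardTable.rotationVector z α) T.liouville ∧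
        0 ≤ (∫ z, BilliardTable.rotationVector z α ∂T.liouville) / T.liouville.real Set.univ ∧
        (∫ z, BilliardTable.rotationVector z α ∂T.liouville) / T.liouville.real Set.univ
          ≤ 1)) := by
  have hφ := BilliardTable.measurable_billiardMap (T := T)
  have hD := BilliardTable.measurableSet_collisionDomain (T := T)
  have hm := BilliardTable.measurable_footpointGain hφ hD
  have hm' : Measurable (BilliardTable.rotationVector (T := T)) :=
    measurable_pi_lambda _ fun α => ((measurable_pi_apply α).comp hm).div_const _
  refine ⟨⟨T.liouville_univ_ne_zero, measure_ne_top _ _⟩,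
    BilliardTable.ae_gainExists BilliardTable.measurePreserving_billiardMap
      BilliardTable.ae_exists_collides,
    BilliardTable.measurableSet_gainExists hφ hD, BilliardTable.gainExists_billiardMap_iff,
    ⟨hm, BilliardTable.footpointGain_billiardMap, BilliardTable.footpointGain_mem, fun α =>
      BilliardTable.integrable_and_average_mem ((measurable_pi_apply α).comp hm)
        fun z => BilliardTable.footpointGain_mem z α⟩,
    hm', fun z => ?_, BilliardTable.rotationVector_mem, fun α =>
      BilliardTable.integrable_and_average_mem ((measurable_pi_apply α).comp hm')
        fun z => BilliardTable.rotationVector_mem z α⟩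
  funext α
  rw [BilliardTable.rotationVector, BilliardTable.rotationVector,
    BilliardTable.footpointGain_billiardMap]
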